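/- Let $d\ge 1$, $r\ge 1$, put $p=\mathscr P_{r-1,d}=\binom{r-1+d}{d}$, and let $\Omega=\{x_1,\dots,x_n\}\subset\mathbb R^d$ be $n$ distinct points. Let $D^{(2r-1)}=[\|x_i-x_j\|_2^{2r-1}]_{i,j}\in\mathbb R^{n\times n}$, and let $V_{\le r-1}\in\mathbb R^{n\times p}$ be the multivariate Vandermonde matrix whose columns are the monomials $x^\alpha$, $|\alpha|\le r-1$, evaluated at $x_1,\dots,x_n$. Assume that $V_{\le r-1}$ has full column rank, and let $p\le m\le n$. Then $\big((-1)^rD^{(2r-1)};V_{\le r-1}\big)$ is a nonnegative pair, i.e. $(-1)^rD^{(2r-1)}$ is symmetric, $u^\top(-1)^rD^{(2r-1)}u\ge 0$ whenever $V_{\le r-1}^\top u=0$, and $V_{\le r-1}$ has full column rank. The fixed-size partial-projection DPP $\mathcal X_\star$ of size $m$ based on this pair, that is, the random subset of $\{1,\dots,n\}$ with $$\mathbb P(\mathcal X_\star=X)=\frac1{Z_\star}\,(-1)^{p}\det\begin{pmatrix}(-1)^rD^{(2r-1)}_{X} & (V_{\le r-1})_{X,:}\\ (V_{\le r-1})_{X,:}^\top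 & 0\end{pmatrix}\quad\text{if }|X|=m,\qquad \mathbb P(\mathcal X_\star=X)=0\quad\text{otherwise},$$ is well defined, where $Z_\star$ is the normalisation constant. Moreover, let $\kappa(x,y)=f(\|x-y\|_2)$ be any stationary kernel on $\mathbb R^d$ (all matrices $[\kappa(y_i,y_j)]_{i,j}$ with $y_1,\dots,y_N\in\mathbb R^d$ are positive semi-definite) with $f$ analytic at $0$ and smoothness order $r$, i.e. $r=\min\{s\ge1: f^{(2s-1)}(0)\ne0\}$. Let $L_\varepsilon=[f(\varepsilon\|x_i-x_j\|_2)]_{i,j=1}^n$. Then for all sufficiently small $\varepsilon>0$ the fixed-size L-ensemble $\mathcal X_\varepsilon\sim|DPP|_m(L_\varepsilon)$, given by $\mathbb P(\mathcal X_\varepsilon=X)=\det (L_\varepsilon)_X\big/\sum_{|Y|=m}\det (L_\varepsilon)_Y$ if $|X|=m$ and $0$ otherwise, is well defined, and for every $X\subseteq\{1,\dots,n\}$ $$\lim_{\varepsilon\to0^+}\mathbb P(\mathcal X_\varepsilon=X)=\mathbb P(\mathcal X_\star=X).$$ In particular the limit law is the same for all stationary kernels with the same smoothness order $r$. -/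

import Mathlib

open Filter Topology

noncomputable section

/-- The points live in `ℝ^d` with the Euclidean norm. -/
abbrev E (d : ℕ) : Type := EuclideanSpace ℝ (Fin d)

/-! ### Kernels and smoothness order -/

/-- `κ` is a stationary kernel on `ℝ^d` with radial profile `f`: it is a positive definite function
(all its Gram matrices are positive semi-definite), `κ x y = f ‖x - y‖`, and `f` is analytic
at `0`. Only the values of `f` on `[0, ∞)` enter `κ`. -/
structure IsStationaryKernel {d : ℕ} (κ : E d → E d → ℝ) (f : ℝ → ℝ) : Prop where
  posSemidef : ∀ (n : ℕ) (x : Fin n → E d),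
    (Matrix.of fun i j => κ (x i) (x j)).PosSemidef
  stationary : ∀ x y, κ x y = f ‖x - y‖
  analytic : AnalyticAt ℝ f 0

/-- The coefficient `f_i = f^(i)(0) / i!` in the expansion of `f` at `0`. -/
def taylorCoeff (f : ℝ → ℝ) (i : ℕ) : ℝ := iteratedDeriv i f 0 / (Nat.factorial i : ℝ)

/-- The (finite) smoothness order of the profile `f` is `r = min {s ≥ 1 | f_{2s-1} ≠ 0}`. -/
def HasSmoothnessOrder (f : ℝ → ℝ) (r : ℕ) : Prop :=
  IsLeast {s : ℕ | 1 ≤ s ∧ taylorCoeff f (2 * s - 1) ≠ 0} r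

/-- The kernel at inverse scale `ε`: `κ_ε(x, y) = κ(ε x, ε y)`. -/
def scaledKernel {d : ℕ} (κ : E d → E d → ℝ) (ε : ℝ) (x y : E d) : ℝ := κ (ε • x) (ε • y)

/-- The kernel matrix `L_ε = [κ_ε(x_i, x_j)]`. -/
def kernelMatrix {d n : ℕ} (κ : E d → E d → ℝ) (ε : ℝ) (x : Fin n → E d) :
    Matrix (Fin n) (Fin n) ℝ :=
  Matrix.of fun i j => scaledKernel κ ε (x i) (x j)

/-! ### Distance and Vandermonde matrices -/

/-- `D^(p) = [‖x_i - x_j‖^p]`. -/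
def distMatrix {d n : ℕ} (x : Fin n → E d) (p : ℕ) : Matrix (Fin n) (Fin n) ℝ :=
  Matrix.of fun i j => ‖x i - x j‖ ^ p

/-- Multi-indices `α ∈ ℕ^d` of total degree `|α| ≤ k` (each component is then at most `k`). -/
abbrev MultiIndex (d k : ℕ) : Type := {α : Fin d → Fin (k + 1) // ∑ i, (α i : ℕ) ≤ k}

/-- The multivariate Vandermonde matrix `V_{≤ k}`: all monomials of degree at most `k`
evaluated at the points. -/
def vandermondeLE {d n : ℕ} (x : Fin n → E d) (k : ℕ) : Matrix (Fin n) (MultiIndex d k) ℝ :=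
  Matrix.of fun i α => ∏ j, (x i j) ^ (α.1 j : ℕ)

/-- `P_{k,d} = C(k+d, d)`, the dimension of the polynomials of degree at most `k` on `ℝ^d`. -/
def polyDim (k d : ℕ) : ℕ := (k + d).choose d

/-! ### Fixed-size L-ensembles and fixed-size partial-projection DPPs

The ground set is identified with its index set `Fin n`; the law of a random subset is a
`PMF (Finset (Fin n))`. -/

/-- The principal minor `det L_X` (equal to `1` for `X = ∅`). -/
def principalMinor {n : ℕ} (L : Matrix (Fin n) (Fin n) ℝ) (X : Finset (Fin n)) : ℝ :=
  (L.submatrix (fun i : X => (i : Fin n)) (fun i : X => (i : Fin n))).det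

/-- `P` is the law of `|DPP|_m(L)`: `P(X) = det L_X / Z_m` if `|X| = m`, and `0` otherwise, where
`Z_m` is the sum of `det L_Y` over `|Y| = m`. As `P` has total mass one, `Z_m ≠ 0`. -/
structure IsFixedSizeLEnsemble {n : ℕ} (m : ℕ) (L : Matrix (Fin n) (Fin n) ℝ)
    (P : PMF (Finset (Fin n))) : Prop where
  posSemidef : L.PosSemidef
  mass : ∀ X, (P X).toReal =
    if X.card = m then
      principalMinor L X / ∑ Y ∈ Finset.powersetCard m Finset.univ, principalMinor L Y
    else 0

/-- `(L; V)` is a nonnegative pair: `L` is symmetric and conditionally positive semi-definite with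
respect to `V`, and `V` has full column rank. -/
structure IsNonnegativePair {n : ℕ} {ι : Type} [Fintype ι]
    (L : Matrix (Fin n) (Fin n) ℝ) (V : Matrix (Fin n) ι ℝ) : Prop where
  symm : L.IsSymm
  condPosSemidef : ∀ u : Fin n → ℝ, Matrix.mulVec V.transpose u = 0 →
    0 ≤ dotProduct u (Matrix.mulVec L u)
  fullColRank : LinearIndependent ℝ V.col

/-- `(-1)^p det [[L_X, V_{X,:}], [V_{X,:}ᵀ, 0]]`, where `p` is the number of columns of `V`. -/
def saddleMinor {n : ℕ} {ι : Type} [Fintype ι] [DecidableEq ι]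
    (L : Matrix (Fin n) (Fin n) ℝ) (V : Matrix (Fin n) ι ℝ) (X : Finset (Fin n)) : ℝ :=
  (-1) ^ Fintype.card ι *
    (Matrix.fromBlocks
      (L.submatrix (fun i : X => (i : Fin n)) (fun i : X => (i : Fin n)))
      (V.submatrix (fun i : X => (i : Fin n)) id)
      (V.submatrix (fun i : X => (i : Fin n)) id).transpose
      0).det

/-- `P` is the law of the fixed-size partial-projection DPP of size `m` based on the nonnegative
pair `(L; V)`: `P(X)` is proportional to the saddle-point minor at `X` if `|X| = m`, and `0`
otherwise. As `P` has total mass one, the normalisation constant is not `0`. -/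
structure IsFixedSizePPDPP {n : ℕ} {ι : Type} [Fintype ι] [DecidableEq ι] (m : ℕ)
    (L : Matrix (Fin n) (Fin n) ℝ) (V : Matrix (Fin n) ι ℝ)
    (P : PMF (Finset (Fin n))) : Prop where
  nonnegativePair : IsNonnegativePair L V
  mass : ∀ X, (P X).toReal =
    if X.card = m then
      saddleMinor L V X / ∑ Y ∈ Finset.powersetCard m Finset.univ, saddleMinor L V Y
    else 0

end

/-! Write `r = q + 1`. Near `0` the profile is an even polynomial of degree at most `2q`, plus `c'
t^(2q+1)` with `c' ≠ 0`, plus `O(t^(2q+2))`. At scale `ε` the even part expands into `w α β * monom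
α x * monom β y` with `|α| + |β| ≤ 2q`, so two exponents of degree above `q` never meet. Let `W` be
the block of coefficients with both degrees at most `q`, and `Δ` the diagonal of the `ε^|α|`. If `W`
is invertible, completing the square gives `K_ε = ε^(2q+1) A + U (Δ W Δ) U'`, with `A → c'
D^(2q+1)`, `U → V` and `U' → Vᵀ`. The determinant lemma turns `det K_ε` into a factor depending only
on `ε` and the number of points, times a saddle determinant whose lower right block tends to `0`
(`exists_tendsto_det_kernel`). The factor cancels in the probabilities, and so does the effect of
the value and sign of `c'`.

The normalisation constant of the limit must not vanish. This follows from strict conditional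
positive definiteness of `(-1)^r ‖x - y‖^(2r-1)` (`norm_pow_condPosDef`): on the line the form is
the integral of a square, and in `ℝ^d` it is an average over directions. Saddle minors are then
positive on sets where `V` has full column rank and zero elsewhere (`det_saddle_pos`,
`det_saddle_eq_zero`).

The delicate point is the invertibility of `W` (`det_wronskian_ne_zero`). A null vector `v` of top
degree `k ≤ q` would make `c' ‖x - y‖^(2q+1)` nonnegative on weights whose moments up to order `2q`
are multiples of the degree-`k` part of `v` (`odd_form_nonneg_of_null`). Cauchy–Schwarz between such
weights, shrunk by `δ`, and weights with no moments bounds the squared cross term by a multiple of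
`δ^(2q+1)`. Its leading behaviour is `δ^(2k)` with `2k ≤ 2q`, so the leading coefficient is zero,
which forces the degree-`k` part of `v` to vanish (`moments_eq_zero_of_nonneg`). -/

/-! ### Determinants of saddle-point matrices. -/

section LinearAlgebra

open Matrix

variable {m ι : Type*} [Fintype m] [DecidableEq m] [Fintype ι] [DecidableEq ι]

theorem pow_mul_det_fromBlocks_smul (t : ℝ) (A : Matrix m m ℝ) (B : Matrix m ι ℝ)
    (C : Matrix ι m ℝ) (D : Matrix ι ι ℝ) :
    t ^ Fintype.card ι * (fromBlocks (t • A) B C D).det =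
      t ^ Fintype.card m * (fromBlocks A B C (t • D)).det := by
  have h : fromBlocks (t • A) B C D * fromBlocks 1 0 0 (t • (1 : Matrix ι ι ℝ)) =
      fromBlocks (t • (1 : Matrix m m ℝ)) 0 0 1 * fromBlocks A B C (t • D) := by
    simp [fromBlocks_multiply]
  have h' := congrArg det h
  rw [det_mul, det_mul, det_fromBlocks_zero₂₁, det_fromBlocks_zero₂₁] at h'
  simp only [det_one, det_smul, one_mul, mul_one] at h'
  rw [mul_comm, h']

/-- Schur complement of the block `-C⁻¹`. This form stays meaningful in the limit where `C⁻¹`,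
suitably rescaled, tends to `0`. -/
theorem det_add_mul_mul (R : Matrix m m ℝ) (U : Matrix m ι ℝ) (C : Matrix ι ι ℝ)
    (U' : Matrix ι m ℝ) (hC : C.det ≠ 0) :
    (R + U * C * U').det =
      (-1) ^ Fintype.card ι * C.det * (fromBlocks R U U' (-C⁻¹)).det := by
  have hu : IsUnit C.det := isUnit_iff_ne_zero.2 hC
  have h1 : (-C⁻¹) * (-C) = 1 := by simp [nonsing_inv_mul C hu]
  have h2 : (-C) * (-C⁻¹) = 1 := by simp [mul_nonsing_inv C hu]
  let _ : Invertible (-C⁻¹) := ⟨-C, h2, h1⟩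
  have h3 : ⅟(-C⁻¹) = -C := rfl
  rw [det_fromBlocks₂₂, h3, det_neg, det_nonsing_inv, Ring.inverse_eq_inv']
  have h4 : R - U * -C * U' = R + U * C * U' := by simp
  rw [h4]
  have h5 : ((-1 : ℝ) ^ Fintype.card ι) * (-1) ^ Fintype.card ι = 1 := by
    rw [← mul_pow]; simp
  field_simp
  linear_combination (-(R + U * C * U').det) * h5

/-- For a kernel vector `(u, w)`, pairing `A u + V w = 0` with `u` and using `Vᵀ u = 0` gives `uᵀ A
u = 0`. Hence `u = 0`, and then `V w = 0`. -/
theorem det_saddle_ne_zero (A : Matrix m m ℝ) (V : Matrix m ι ℝ)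
    (hA : ∀ u, Vᵀ *ᵥ u = 0 → u ≠ 0 → 0 < u ⬝ᵥ A *ᵥ u) (hV : ∀ w, V *ᵥ w = 0 → w = 0) :
    (fromBlocks A V Vᵀ 0).det ≠ 0 := by
  intro h
  obtain ⟨v, hv, h0⟩ := exists_mulVec_eq_zero_iff.2 h
  have hv' : v = Sum.elim (v ∘ Sum.inl) (v ∘ Sum.inr) := (Sum.elim_comp_inl_inr v).symm
  rw [fromBlocks_mulVec] at h0
  have h1 := congrArg (fun z => z ∘ Sum.inl) h0
  have h2 := congrArg (fun z => z ∘ Sum.inr) h0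
  simp only [Sum.elim_comp_inl, Sum.elim_comp_inr, zero_mulVec, add_zero] at h1 h2
  have h2' : Vᵀ *ᵥ (v ∘ Sum.inl) = 0 := h2
  have h1' : A *ᵥ (v ∘ Sum.inl) + V *ᵥ (v ∘ Sum.inr) = 0 := h1
  have hu : v ∘ Sum.inl = 0 := by
    by_contra hne
    have := hA _ h2' hne
    have h3 := congrArg (fun z => (v ∘ Sum.inl) ⬝ᵥ z) h1'
    simp only [dotProduct_add, dotProduct_zero] at h3
    rw [dotProduct_mulVec _ V, ← mulVec_transpose, h2', zero_dotProduct] at h3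
    linarith
  rw [hu] at h1'
  simp only [mulVec_zero, zero_add] at h1'
  have hw := hV _ h1'
  apply hv
  rw [hv', hu, hw]
  ext i; cases i <;> rfl

theorem det_saddle_eq_zero (A : Matrix m m ℝ) (V : Matrix m ι ℝ)
    (hV : ¬ ∀ w, V *ᵥ w = 0 → w = 0) :
    (fromBlocks A V Vᵀ 0).det = 0 := by
  push Not at hV
  obtain ⟨w, hw, hne⟩ := hV
  refine exists_mulVec_eq_zero_iff.1 ⟨Sum.elim 0 w, ?_, ?_⟩
  · intro h
    exact hne (by simpa using congrArg (fun z => z ∘ Sum.inr) h)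
  · rw [fromBlocks_mulVec]
    ext i
    cases i <;> simp [hw]

/-- Deform `A` linearly to the identity. The hypothesis on `A` survives along the path, so the
determinant never vanishes and keeps its sign. At the end the signed determinant is `det (Vᵀ V) >
0`. -/
theorem det_saddle_pos (A : Matrix m m ℝ) (V : Matrix m ι ℝ)
    (hA : ∀ u, Vᵀ *ᵥ u = 0 → u ≠ 0 → 0 < u ⬝ᵥ A *ᵥ u) (hV : ∀ w, V *ᵥ w = 0 → w = 0) :
    0 < (-1) ^ Fintype.card ι * (fromBlocks A V Vᵀ 0).det := by
  let g : ℝ → ℝ := fun s =>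
    (-1) ^ Fintype.card ι * (fromBlocks ((1 - s) • A + s • 1) V Vᵀ 0).det
  have hg : Continuous g := by
    refine continuous_const.mul (Continuous.matrix_det ?_)
    exact Continuous.matrix_fromBlocks (by fun_prop) continuous_const continuous_const
      continuous_const
  have hne : ∀ s ∈ Set.Icc (0 : ℝ) 1, g s ≠ 0 := by
    intro s hs
    refine mul_ne_zero (pow_ne_zero _ (by norm_num)) (det_saddle_ne_zero _ _ ?_ hV)
    intro u hu hu0
    have h1 := hA u hu hu0
    have h2 : 0 < u ⬝ᵥ u := by
      rcases (show 0 ≤ u ⬝ᵥ u from Finset.sum_nonneg fun i _ => mul_self_nonneg _).lt_or_eq with h | h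
      · exact h
      · exact absurd (dotProduct_self_eq_zero.1 h.symm) hu0
    simp only [add_mulVec, smul_mulVec, one_mulVec, dotProduct_add, dotProduct_smul, smul_eq_mul]
    rcases hs.1.eq_or_lt with h | h
    · subst h; simpa using h1
    · have := mul_nonneg (sub_nonneg.2 hs.2) h1.le
      have := mul_pos h h2
      linarith
  have h1 : 0 < g 1 := by
    have h3 : (Vᵀ * V).PosDef := by
      have := PosDef.conjTranspose_mul_self V ?_
      · simpa using this
      · intro a b hab
        have : V *ᵥ (a - b) = 0 := by rw [mulVec_sub]; exact sub_eq_zero.2 hab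
        exact sub_eq_zero.1 (hV _ this)
    have h4 : g 1 = (Vᵀ * V).det := by
      simp only [g, sub_self, zero_smul, one_smul, zero_add]
      rw [det_fromBlocks_one₁₁, zero_sub, det_neg, ← mul_assoc, ← mul_pow]
      simp
    rw [h4]; exact h3.det_pos
  have h0 : g 0 = (-1) ^ Fintype.card ι * (fromBlocks A V Vᵀ 0).det := by simp [g]
  rw [← h0]
  by_contra hcon
  obtain ⟨s, hs, hs0⟩ := intermediate_value_Icc zero_le_one hg.continuousOn
    ⟨not_lt.1 hcon, h1.le⟩
  exact hne s hs hs0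

end LinearAlgebra

/-! ### Conditional positive definiteness of odd powers of the distance on the line. -/

section OneDimensional

open MeasureTheory

/-- The signed power `sgn(t) t ^ q`. -/
noncomputable def signedPow (q : ℕ) (t : ℝ) : ℝ := if 0 ≤ t then t ^ q else -t ^ q

theorem measurable_signedPow (q : ℕ) : Measurable (signedPow q) :=
  Measurable.ite measurableSet_Ici (by fun_prop) (by fun_prop)

theorem abs_signedPow (q : ℕ) (t : ℝ) : |signedPow q t| = |t ^ q| := by
  unfold signedPow
  split_ifs <;> simp

/-- The value `∫₀¹ z^q (1-z)^q dz` of the Beta integral. -/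
noncomputable def betaSq (q : ℕ) : ℝ := ∫ z in (0 : ℝ)..1, z ^ q * (1 - z) ^ q

theorem betaSq_pos (q : ℕ) : 0 < betaSq q := by
  refine intervalIntegral.intervalIntegral_pos_of_pos_on ?_ ?_ zero_lt_one
  · exact Continuous.intervalIntegrable (by fun_prop) _ _
  · intro z hz
    exact mul_pos (pow_pos hz.1 _) (pow_pos (sub_pos.2 hz.2) _)

theorem integral_mul_pow_eq_betaSq (q : ℕ) {s t : ℝ} (hst : s ≤ t) :
    ∫ z in s..t, (s - z) ^ q * (t - z) ^ q = (-1) ^ q * betaSq q * |s - t| ^ (2 * q + 1) := by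
  rcases hst.eq_or_lt with rfl | hlt
  · simp
  have h := intervalIntegral.integral_comp_mul_add (a := 0) (b := 1)
    (fun z => (s - z) ^ q * (t - z) ^ q) (c := t - s) (sub_ne_zero.2 hlt.ne') s
  have h2 : ∀ z : ℝ, (s - ((t - s) * z + s)) ^ q * (t - ((t - s) * z + s)) ^ q =
      (-1) ^ q * (t - s) ^ (2 * q) * (z ^ q * (1 - z) ^ q) := by
    intro z
    rw [two_mul, pow_add, ← mul_pow, ← mul_pow, ← mul_pow, ← mul_pow, ← mul_pow]
    congr 1
    ring
  simp only [h2, mul_zero, zero_add, mul_one, sub_add_cancel, smul_eq_mul] at h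
  rw [intervalIntegral.integral_const_mul] at h
  have hne : t - s ≠ 0 := sub_ne_zero.2 hlt.ne'
  rw [eq_inv_mul_iff_mul_eq₀ hne] at h
  rw [← h, abs_sub_comm, abs_of_pos (sub_pos.2 hlt), betaSq]
  ring

theorem integrableOn_signedPow_mul (q : ℕ) (s t T₀ T₁ : ℝ) :
    IntegrableOn (fun z => signedPow q (s - z) * signedPow q (t - z)) (Set.Ioc T₀ T₁) := by
  have hc : IntegrableOn (fun z => (s - z) ^ q * (t - z) ^ q) (Set.Ioc T₀ T₁) :=
    (Continuous.integrableOn_Icc (by fun_prop)).mono_set Set.Ioc_subset_Icc_self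
  refine Integrable.mono hc ?_ (Eventually.of_forall fun z => ?_)
  · exact (((measurable_signedPow q).comp (by fun_prop)).mul
      ((measurable_signedPow q).comp (by fun_prop))).aestronglyMeasurable
  · rw [Real.norm_eq_abs, Real.norm_eq_abs, abs_mul, abs_mul, abs_signedPow, abs_signedPow]

/-- The two integrands agree except for `z` between `s` and `t`, where the sign flips. That interval
contributes a Beta integral, the source of `|s - t|^(2q+1)`. -/
theorem integral_signedPow_mul (q : ℕ) {s t T₀ T₁ : ℝ} (hs : T₀ ≤ s) (ht : T₀ ≤ t)
    (hs' : s ≤ T₁) (ht' : t ≤ T₁) :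
    ∫ z in Set.Ioc T₀ T₁, signedPow q (s - z) * signedPow q (t - z) =
      (∫ z in Set.Ioc T₀ T₁, (s - z) ^ q * (t - z) ^ q) +
        2 * betaSq q * ((-1) ^ (q + 1) * |s - t| ^ (2 * q + 1)) := by
  wlog hst : s ≤ t generalizing s t
  · have := this ht hs ht' hs' (le_of_not_ge hst)
    rw [abs_sub_comm]
    simpa only [mul_comm (signedPow q (s - _)), mul_comm ((s - _) ^ q)] using this
  have hpt : ∀ z, signedPow q (s - z) * signedPow q (t - z) = (s - z) ^ q * (t - z) ^ q -
      (Set.Ioc s t).indicator (fun z => 2 * ((s - z) ^ q * (t - z) ^ q)) z := by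
    intro z
    by_cases h1 : z ≤ s
    · have h2 : z ≤ t := h1.trans hst
      simp [signedPow, h1, h2, Set.indicator, h1.not_gt]
    · by_cases h2 : z ≤ t
      · simp [signedPow, h1, h2, Set.indicator, not_le.1 h1]; ring
      · simp [signedPow, h1, h2, Set.indicator]
  have hc : ∀ T₀ T₁ : ℝ, IntegrableOn (fun z => (s - z) ^ q * (t - z) ^ q) (Set.Ioc T₀ T₁) :=
    fun T₀ T₁ => (Continuous.integrableOn_Icc (by fun_prop)).mono_set Set.Ioc_subset_Icc_self
  simp only [hpt]
  rw [integral_sub (hc _ _), setIntegral_indicator measurableSet_Ioc,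
    Set.inter_eq_self_of_subset_right (Set.Ioc_subset_Ioc hs ht'), integral_const_mul,
    ← intervalIntegral.integral_of_le hst, integral_mul_pow_eq_betaSq q hst]
  · ring
  · exact ((hc _ _).const_mul 2).indicator measurableSet_Ioc

variable {ι : Type*} [Fintype ι]

theorem sum_mul_sub_pow_eq_zero {q : ℕ} {u t : ι → ℝ}
    (h : ∀ l ≤ q, ∑ i, u i * t i ^ l = 0) (z : ℝ) : ∑ i, u i * (t i - z) ^ q = 0 := by
  simp only [sub_eq_add_neg, add_pow, Finset.mul_sum]
  rw [Finset.sum_comm]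
  refine Finset.sum_eq_zero fun l hl => ?_
  have h1 := h l (Nat.lt_succ_iff.1 (Finset.mem_range.1 hl))
  calc ∑ i, u i * (t i ^ l * (-z) ^ (q - l) * (q.choose l))
      = (∑ i, u i * t i ^ l) * ((-z) ^ (q - l) * (q.choose l)) := by
        rw [Finset.sum_mul]; exact Finset.sum_congr rfl fun i _ => by ring
    _ = 0 := by rw [h1, zero_mul]

/-- After squaring, the polynomial parts of the pair integrals cancel because the moments up to
order `q` vanish. Only the distance terms remain. -/
theorem integral_sq_sum_signedPow {q : ℕ} {u t : ι → ℝ}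
    (h : ∀ l ≤ q, ∑ i, u i * t i ^ l = 0) {T₀ T₁ : ℝ} (h0 : ∀ i, T₀ ≤ t i) (h1 : ∀ i, t i ≤ T₁) :
    ∫ z in Set.Ioc T₀ T₁, (∑ i, u i * signedPow q (t i - z)) ^ 2 =
      2 * betaSq q * ((-1) ^ (q + 1) * ∑ i, ∑ j, u i * u j * |t i - t j| ^ (2 * q + 1)) := by
  have hc : ∀ i j, IntegrableOn (fun z => (t i - z) ^ q * (t j - z) ^ q) (Set.Ioc T₀ T₁) :=
    fun i j => (Continuous.integrableOn_Icc (by fun_prop)).mono_set Set.Ioc_subset_Icc_self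
  have hsq : ∀ a : ι → ℝ, (∑ i, u i * a i) ^ 2 = ∑ i, ∑ j, u i * u j * (a i * a j) := by
    intro a
    rw [sq, Finset.sum_mul_sum]
    exact Finset.sum_congr rfl fun i _ => Finset.sum_congr rfl fun j _ => by ring
  have hz : ∑ i, ∑ j, u i * u j * ∫ z in Set.Ioc T₀ T₁, (t i - z) ^ q * (t j - z) ^ q = 0 := by
    simp only [← integral_const_mul]
    rw [Finset.sum_congr rfl fun i _ =>
      (integral_finsetSum Finset.univ fun j _ => (hc i j).const_mul (u i * u j)).symm]
    rw [← integral_finsetSum Finset.univ fun i _ =>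
      integrable_finsetSum Finset.univ fun j _ => (hc i j).const_mul (u i * u j)]
    simp only [← hsq, sum_mul_sub_pow_eq_zero h]
    simp
  simp only [hsq]
  rw [integral_finsetSum Finset.univ fun i _ => integrable_finsetSum Finset.univ fun j _ =>
    (integrableOn_signedPow_mul q (t i) (t j) T₀ T₁).const_mul (u i * u j)]
  simp only [integral_finsetSum Finset.univ fun j _ =>
    (integrableOn_signedPow_mul q (t _) (t j) T₀ T₁).const_mul (u _ * u j), integral_const_mul,
    integral_signedPow_mul q (h0 _) (h0 _) (h1 _) (h1 _), mul_add, Finset.sum_add_distrib, hz,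
    zero_add, Finset.mul_sum]
  exact Finset.sum_congr rfl fun i _ => Finset.sum_congr rfl fun j _ => by ring

theorem exists_bounds (t : ι → ℝ) : ∃ T₀ T₁ : ℝ, ∀ i, T₀ < t i ∧ t i ≤ T₁ := by
  obtain ⟨M, hM⟩ := (Set.finite_range fun i => |t i|).bddAbove
  refine ⟨-M - 1, M, fun i => ?_⟩
  have := abs_le.1 (hM ⟨i, rfl⟩)
  exact ⟨by linarith, this.2⟩

/-- `(-1)^(q+1) |s - t|^(2q+1)` is conditionally positive semi-definite on the line. -/
theorem abs_pow_condPosSemidef {q : ℕ} {u t : ι → ℝ} (h : ∀ l ≤ q, ∑ i, u i * t i ^ l = 0) :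
    0 ≤ (-1) ^ (q + 1) * ∑ i, ∑ j, u i * u j * |t i - t j| ^ (2 * q + 1) := by
  obtain ⟨T₀, T₁, hT⟩ := exists_bounds t
  have h1 := integral_sq_sum_signedPow h (fun i => (hT i).1.le) (fun i => (hT i).2)
  have h2 : 0 ≤ ∫ z in Set.Ioc T₀ T₁, (∑ i, u i * signedPow q (t i - z)) ^ 2 :=
    integral_nonneg fun z => sq_nonneg _
  rw [h1] at h2
  exact nonneg_of_mul_nonneg_right h2 (mul_pos two_pos (betaSq_pos q))

/-- Just to the left of the rightmost point `t i₀` of nonzero weight, all other active terms carry a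
minus sign. The vanishing moments reduce the sum there to `2 u i₀ (t i₀ - z)^q`, so its square has
positive integral. -/
theorem abs_pow_condPosDef {q : ℕ} {u t : ι → ℝ} (h : ∀ l ≤ q, ∑ i, u i * t i ^ l = 0)
    (ht : Function.Injective t) (hu : u ≠ 0) :
    0 < (-1) ^ (q + 1) * ∑ i, ∑ j, u i * u j * |t i - t j| ^ (2 * q + 1) := by
  classical
  obtain ⟨T₀, T₁, hT⟩ := exists_bounds t
  have h1 := integral_sq_sum_signedPow h (fun i => (hT i).1.le) (fun i => (hT i).2)
  obtain ⟨i₁, hi₁⟩ := Function.ne_iff.1 hu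
  obtain ⟨i₀, hi₀, hmax⟩ := Finset.exists_max_image (Finset.univ.filter fun i => u i ≠ 0) t
    ⟨i₁, by simpa using hi₁⟩
  have hi₀ : u i₀ ≠ 0 := by simpa using hi₀
  have hlt : ∀ i, u i ≠ 0 → i ≠ i₀ → t i < t i₀ := fun i hi hne =>
    lt_of_le_of_ne (hmax i (by simpa using hi)) (fun h => hne (ht h))
  -- `a` is the second largest point of nonzero weight, or `T₀` if there is none.
  obtain ⟨a, ha0, hat, ha⟩ : ∃ a, T₀ ≤ a ∧ a < t i₀ ∧ ∀ i, u i ≠ 0 → i ≠ i₀ → t i ≤ a := by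
    by_cases hne : (Finset.univ.filter fun i => u i ≠ 0 ∧ i ≠ i₀).Nonempty
    · obtain ⟨j, hj, hjm⟩ := Finset.exists_max_image _ t hne
      simp only [Finset.mem_filter, Finset.mem_univ, true_and] at hj hjm
      exact ⟨t j, (hT j).1.le, hlt j hj.1 hj.2, fun i h1 h2 => hjm i ⟨h1, h2⟩⟩
    · refine ⟨T₀, le_rfl, (hT i₀).1, fun i h1 h2 => ?_⟩
      exact absurd ⟨i, by simp [h1, h2]⟩ hne
  have hval : ∀ z ∈ Set.Ioo a (t i₀),
      ∑ i, u i * signedPow q (t i - z) = 2 * u i₀ * (t i₀ - z) ^ q := by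
    intro z hz
    have h2 := sum_mul_sub_pow_eq_zero h z
    have h3 : ∀ i, u i * signedPow q (t i - z) =
        -(u i * (t i - z) ^ q) + if i = i₀ then 2 * u i₀ * (t i₀ - z) ^ q else 0 := by
      intro i
      by_cases hi : i = i₀
      · subst hi
        simp [signedPow, hz.2.le]; ring
      · by_cases hui : u i = 0
        · simp [hui, hi]
        · have : ¬ z ≤ t i := not_le.2 (lt_of_le_of_lt (ha i hui hi) hz.1)
          simp [signedPow, this, hi]
    rw [Finset.sum_congr rfl fun i _ => h3 i, Finset.sum_add_distrib, Finset.sum_neg_distrib, h2]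
    simp
  have hInt : IntegrableOn (fun z => (∑ i, u i * signedPow q (t i - z)) ^ 2) (Set.Ioc T₀ T₁) := by
    simp only [sq, Finset.sum_mul_sum]
    refine integrable_finsetSum _ fun i _ => integrable_finsetSum _ fun j _ => ?_
    exact ((integrableOn_signedPow_mul q (t i) (t j) T₀ T₁).const_mul (u i * u j)).congr
      (Eventually.of_forall fun z => by simp only; ring)
  have h2 : 0 < ∫ z in Set.Ioc T₀ T₁, (∑ i, u i * signedPow q (t i - z)) ^ 2 := by
    refine lt_of_lt_of_le ?_ (setIntegral_mono_set (s := Set.Ioo a (t i₀)) hInt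
      (Eventually.of_forall fun z => sq_nonneg _) (Filter.Eventually.of_forall ?_))
    · rw [setIntegral_congr_fun measurableSet_Ioo
        (fun z hz => by simp only [hval z hz] :
          Set.EqOn _ (fun z => (2 * u i₀ * (t i₀ - z) ^ q) ^ 2) _),
        ← integral_Ioc_eq_integral_Ioo, ← intervalIntegral.integral_of_le hat.le]
      refine intervalIntegral.intervalIntegral_pos_of_pos_on ?_ ?_ hat
      · exact Continuous.intervalIntegrable (by fun_prop) _ _
      · intro z hz
        have : 0 < (t i₀ - z) ^ q := pow_pos (sub_pos.2 hz.2) _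
        positivity
    · intro z hz
      exact ⟨lt_of_le_of_lt ha0 hz.1, hz.2.le.trans (hT i₀).2⟩
  rw [h1] at h2
  exact pos_of_mul_pos_right h2 (mul_pos two_pos (betaSq_pos q)).le

end OneDimensional

/-! ### From the line to `ℝ^d` by averaging over directions in the unit ball. -/

section Averaging

open MeasureTheory

variable {d : ℕ}

/-- The monomial `x ^ α`. -/
def monom (α : Fin d → ℕ) (x : E d) : ℝ := ∏ j, x j ^ α j

theorem monom_smul (α : Fin d → ℕ) (t : ℝ) (x : E d) :
    monom α (t • x) = t ^ (∑ j, α j) * monom α x := by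
  simp [monom, mul_pow, Finset.prod_mul_distrib, Finset.prod_pow_eq_pow_sum]

theorem inner_pow_eq_sum_monom (g x : E d) (l : ℕ) :
    (inner ℝ g x) ^ l = ∑ α ∈ Finset.piAntidiag Finset.univ l,
      (Nat.multinomial Finset.univ α : ℝ) * monom α g * monom α x := by
  have h : inner ℝ g x = ∑ j, g j * x j := by
    simp [PiLp.inner_apply, mul_comm]
  rw [h, Finset.sum_pow_eq_sum_piAntidiag]
  refine Finset.sum_congr rfl fun α _ => ?_
  simp only [monom, mul_pow, Finset.prod_mul_distrib, mul_assoc]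

theorem sum_mul_inner_pow {ι : Type*} [Fintype ι] (u : ι → ℝ) (x : ι → E d) (g : E d) (l : ℕ) :
    ∑ i, u i * (inner ℝ g (x i)) ^ l = ∑ α ∈ Finset.piAntidiag Finset.univ l,
      (Nat.multinomial Finset.univ α : ℝ) * monom α g * ∑ i, u i * monom α (x i) := by
  simp only [inner_pow_eq_sum_monom, Finset.mul_sum]
  rw [Finset.sum_comm]
  exact Finset.sum_congr rfl fun α _ => Finset.sum_congr rfl fun i _ => by ring

theorem sum_mul_inner_pow_eq_zero {ι : Type*} [Fintype ι] {u : ι → ℝ} {x : ι → E d} {l : ℕ}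
    (h : ∀ α : Fin d → ℕ, ∑ j, α j = l → ∑ i, u i * monom α (x i) = 0) (g : E d) :
    ∑ i, u i * (inner ℝ g (x i)) ^ l = 0 := by
  rw [sum_mul_inner_pow]
  refine Finset.sum_eq_zero fun α hα => ?_
  rw [h α (Finset.mem_piAntidiag.1 hα).1, mul_zero]

theorem integrableOn_unitBall {h : E d → ℝ} (hc : Continuous h) :
    IntegrableOn h (Metric.closedBall 0 1) :=
  hc.continuousOn.integrableOn_compact (isCompact_closedBall _ _)

theorem eq_zero_of_integral_unitBall_eq_zero {h : E d → ℝ} (hc : Continuous h)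
    (h0 : ∀ g, 0 ≤ h g) (hInt : ∫ g in Metric.closedBall 0 1, h g = 0) {g : E d}
    (hg : ‖g‖ < 1) : h g = 0 := by
  have h1 := (setIntegral_eq_zero_iff_of_nonneg_ae (Eventually.of_forall h0)
    (integrableOn_unitBall hc)).1 hInt
  have h2 : h =ᵐ[volume.restrict (Metric.ball 0 1)] (fun _ => (0 : ℝ)) :=
    ae_restrict_of_ae_restrict_of_subset Metric.ball_subset_closedBall h1
  exact Measure.eqOn_open_of_ae_eq h2 Metric.isOpen_ball hc.continuousOn continuousOn_const
    (by simpa using hg)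

theorem integral_unitBall_pos {h : E d → ℝ} (hc : Continuous h)
    (h0 : ∀ g, 0 ≤ h g) {g : E d} (hg : ‖g‖ < 1) (hpos : h g ≠ 0) :
    0 < ∫ g in Metric.closedBall 0 1, h g :=
  lt_of_le_of_ne (integral_nonneg h0) fun h1 =>
    hpos (eq_zero_of_integral_unitBall_eq_zero hc h0 h1.symm hg)

/-- By rotation invariance, odd powers of the norm are averages of powers of linear forms. -/
theorem exists_integral_abs_inner_pow (hd : 1 ≤ d) (k : ℕ) :
    ∃ c : ℝ, 0 < c ∧ ∀ z : E d,
      ∫ g in Metric.closedBall 0 1, |inner ℝ g z| ^ k = c * ‖z‖ ^ k := by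
  let e : E d := EuclideanSpace.single ⟨0, hd⟩ 1
  have he : ‖e‖ = 1 := by simp [e]
  refine ⟨∫ g in Metric.closedBall 0 1, |inner ℝ g e| ^ k, ?_, fun z => ?_⟩
  · refine integral_unitBall_pos (by fun_prop) (fun g => by positivity) (g := (1 / 2 : ℝ) • e)
      (by rw [norm_smul, he]; norm_num) ?_
    rw [inner_smul_left, real_inner_self_eq_norm_sq, he]
    norm_num
  · have hn : ‖z‖ = ‖‖z‖ • e‖ := by rw [norm_smul, he]; simp
    -- This reflection exchanges `z` and `‖z‖ • e` and preserves the ball and its measure.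
    let R : E d ≃ₗᵢ[ℝ] E d := (Submodule.span ℝ {z - ‖z‖ • e})ᗮ.reflection
    have hR : R z = ‖z‖ • e := Submodule.reflection_sub hn
    have hpre : R ⁻¹' Metric.closedBall 0 1 = Metric.closedBall 0 1 := by
      ext g; simp
    have h1 := R.measurePreserving.setIntegral_preimage_emb
      R.toHomeomorph.measurableEmbedding (fun g => |inner ℝ g (‖z‖ • e)| ^ k)
      (Metric.closedBall 0 1)
    rw [hpre] at h1
    have h2 : ∀ g, inner ℝ (R g) (‖z‖ • e) = inner ℝ g z := fun g => by
      rw [← hR, R.inner_map_map]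
    simp only [h2] at h1
    rw [h1, ← integral_mul_const]
    refine integral_congr_ae (Eventually.of_forall fun g => ?_)
    simp only [inner_smul_right, abs_mul, abs_norm, mul_pow]
    ring

/-- `(-1)^(q+1) ‖x - y‖^(2q+1)` is strictly conditionally positive definite of order `q + 1`. -/
theorem norm_pow_condPosDef (hd : 1 ≤ d) {ι : Type*} [Fintype ι] {q : ℕ} {u : ι → ℝ}
    {x : ι → E d} (hx : Function.Injective x) (hu : u ≠ 0)
    (h : ∀ α : Fin d → ℕ, ∑ j, α j ≤ q → ∑ i, u i * monom α (x i) = 0) :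
    0 < (-1) ^ (q + 1) * ∑ i, ∑ j, u i * u j * ‖x i - x j‖ ^ (2 * q + 1) := by
  obtain ⟨c, hc, hInt⟩ := exists_integral_abs_inner_pow hd (2 * q + 1)
  let H : E d → ℝ := fun g => (-1) ^ (q + 1) * ∑ i, ∑ j, u i * u j *
    |inner ℝ g (x i) - inner ℝ g (x j)| ^ (2 * q + 1)
  have hHc : Continuous H := by fun_prop
  have hmom : ∀ g, ∀ l ≤ q, ∑ i, u i * (inner ℝ g (x i)) ^ l = 0 := fun g l hl =>
    sum_mul_inner_pow_eq_zero (fun α hα => h α (hα ▸ hl)) g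
  have hH0 : ∀ g, 0 ≤ H g := fun g => abs_pow_condPosSemidef (hmom g)
  have hHint : ∫ g in Metric.closedBall 0 1, H g =
      c * ((-1) ^ (q + 1) * ∑ i, ∑ j, u i * u j * ‖x i - x j‖ ^ (2 * q + 1)) := by
    simp only [H, ← inner_sub_right]
    rw [integral_const_mul, integral_finsetSum _ fun i _ =>
      integrableOn_unitBall (by fun_prop)]
    rw [Finset.sum_congr rfl fun i _ => integral_finsetSum _ fun j _ =>
      integrableOn_unitBall (by fun_prop)]
    simp only [integral_const_mul, hInt, Finset.mul_sum]
    exact Finset.sum_congr rfl fun i _ => Finset.sum_congr rfl fun j _ => by ring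
  -- A direction orthogonal to no difference of two points keeps the projections distinct, so the
  -- one-dimensional form is strictly positive there. Continuity then makes the average positive.
  obtain ⟨g, hg⟩ := Module.Dual.exists_forall_ne_zero_of_forall_exists
    (ι := {p : ι × ι // p.1 ≠ p.2})
    (fun p => ((innerSL ℝ (x p.1.1 - x p.1.2) : E d →L[ℝ] ℝ) : Module.Dual ℝ (E d)))
    (fun p => ⟨x p.1.1 - x p.1.2, by
      have : x p.1.1 - x p.1.2 ≠ 0 := sub_ne_zero.2 fun h => p.2 (hx h)
      exact inner_self_ne_zero.2 this⟩)
  let t : ℝ := (‖g‖ + 1)⁻¹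
  have ht : 0 < t := by positivity
  have hinj : Function.Injective fun i => inner ℝ (t • g) (x i) := by
    intro i j hij
    by_contra hne
    apply hg ⟨(i, j), hne⟩
    simp only [inner_smul_left, RCLike.conj_to_real] at hij
    have := mul_left_cancel₀ ht.ne' hij
    change inner ℝ (x i - x j) g = 0
    rw [real_inner_comm, inner_sub_right, this, sub_self]
  have hpos := integral_unitBall_pos hHc hH0 (g := t • g) (by
    rw [norm_smul, Real.norm_of_nonneg ht.le, inv_mul_lt_iff₀ (by positivity)]; linarith)
    (abs_pow_condPosDef (hmom _) hinj hu).ne'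
  rw [hHint] at hpos
  exact pos_of_mul_pos_right hpos hc.le

end Averaging

/-! ### Monomials, moments on a grid, and multi-indices. -/

section Monomials

variable {d : ℕ}

/-- On a grid every functional on polynomials is a combination of point evaluations. -/
theorem exists_grid_moments (d K : ℕ) : ∃ Y : (Fin d → Fin (K + 1)) → E d,
    ∀ m : (Fin d → ℕ) → ℝ, ∃ a : (Fin d → Fin (K + 1)) → ℝ,
      ∀ α : Fin d → ℕ, (∀ j, α j ≤ K) → ∑ y, a y * monom α (Y y) = m α := by
  let M : Matrix (Fin (K + 1)) (Fin (K + 1)) ℝ := Matrix.vandermonde fun i => ((i : ℕ) : ℝ)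
  have hM : IsUnit M.det := by
    refine isUnit_iff_ne_zero.2 (Matrix.det_vandermonde_ne_zero_iff.2 fun i j h => ?_)
    exact Fin.ext (by exact_mod_cast h)
  have hinv : ∀ l l' : Fin (K + 1),
      ∑ i, M⁻¹ l i * (((i : ℕ) : ℝ) ^ (l' : ℕ)) = if l = l' then 1 else 0 := by
    intro l l'
    have := congrFun (congrFun (Matrix.nonsing_inv_mul M hM) l) l'
    rwa [Matrix.mul_apply, Matrix.one_apply] at this
  -- The weights are tensor products of rows of the inverse Vandermonde matrix, each dual to one
  -- monomial, combined with coefficients `m`.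
  refine ⟨fun y => WithLp.toLp 2 fun j => ((y j : ℕ) : ℝ), fun m =>
    ⟨fun y => ∑ β : Fin d → Fin (K + 1), m (fun j => (β j : ℕ)) * ∏ j, M⁻¹ (β j) (y j),
      fun α hα => ?_⟩⟩
  let α' : Fin d → Fin (K + 1) := fun j => ⟨α j, Nat.lt_succ_of_le (hα j)⟩
  have h1 : ∀ β : Fin d → Fin (K + 1),
      ∑ y : Fin d → Fin (K + 1), (∏ j, M⁻¹ (β j) (y j)) * ∏ j, (((y j : ℕ) : ℝ)) ^ α j =
        if β = α' then 1 else 0 := by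
    intro β
    simp only [← Finset.prod_mul_distrib]
    rw [← Fintype.prod_sum (fun j i => M⁻¹ (β j) i * (((i : Fin (K + 1)) : ℕ) : ℝ) ^ α j)]
    rw [Finset.prod_congr rfl fun j _ => hinv (β j) (α' j), Finset.prod_ite_zero]
    simp [funext_iff]
  simp only [monom, Finset.sum_mul]
  rw [Finset.sum_comm]
  simp only [mul_assoc, ← Finset.mul_sum, h1]
  simp [α']

/-- Exponents with all entries below `k`. -/
def expBox (d k : ℕ) : Finset (Fin d → ℕ) := Fintype.piFinset fun _ => Finset.range k

/-- Polynomials in `‖x - y‖²` expand into products of monomials. -/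
theorem exists_monom_expansion (d q : ℕ) (c : ℕ → ℝ) :
    ∃ w : (Fin d → ℕ) → (Fin d → ℕ) → ℝ,
      (∀ α β, 2 * q < ∑ j, α j + ∑ j, β j → w α β = 0) ∧
      ∀ x y : E d, ∑ s ∈ Finset.range (q + 1), c s * ‖x - y‖ ^ (2 * s) =
        ∑ α ∈ expBox d (2 * q + 1), ∑ β ∈ expBox d (2 * q + 1),
          w α β * monom α x * monom β y := by
  classical
  let P : MvPolynomial (Fin d ⊕ Fin d) ℝ := ∑ s ∈ Finset.range (q + 1), MvPolynomial.C (c s) *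
    (∑ j, (MvPolynomial.X (Sum.inl j) - MvPolynomial.X (Sum.inr j)) ^ 2) ^ s
  have hdeg : P.totalDegree ≤ 2 * q := by
    refine MvPolynomial.totalDegree_finsetSum_le fun s hs => ?_
    refine (MvPolynomial.totalDegree_mul _ _).trans ?_
    rw [MvPolynomial.totalDegree_C, zero_add]
    refine (MvPolynomial.totalDegree_pow _ _).trans ?_
    have h1 : (∑ j : Fin d, (MvPolynomial.X (R := ℝ) (Sum.inl j : Fin d ⊕ Fin d) -
        MvPolynomial.X (Sum.inr j)) ^ 2).totalDegree ≤ 2 := by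
      refine MvPolynomial.totalDegree_finsetSum_le fun j _ => ?_
      refine (MvPolynomial.totalDegree_pow _ _).trans ?_
      have := (MvPolynomial.totalDegree_sub (MvPolynomial.X (R := ℝ) (Sum.inl j : Fin d ⊕ Fin d))
        (MvPolynomial.X (Sum.inr j)))
      simp only [MvPolynomial.totalDegree_X, max_self] at this
      omega
    have h2 := Finset.mem_range.1 hs
    calc s * _ ≤ q * 2 := Nat.mul_le_mul (by omega) h1
      _ = 2 * q := by ring
  let A : (Fin d ⊕ Fin d →₀ ℕ) → (Fin d → ℕ) × (Fin d → ℕ) :=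
    fun e => (fun j => e (Sum.inl j), fun j => e (Sum.inr j))
  have hA : ∀ e ∈ P.support, ∑ j, (A e).1 j + ∑ j, (A e).2 j ≤ 2 * q := by
    intro e he
    have h1 := MvPolynomial.le_totalDegree he
    rw [Finsupp.sum_fintype _ _ (fun _ => rfl), Fintype.sum_sum_type] at h1
    exact h1.trans hdeg
  -- The filter contains at most one exponent, since `A` only splits `e` into its two halves.
  refine ⟨fun α β => ∑ e ∈ P.support.filter (fun e => A e = (α, β)), P.coeff e, ?_, ?_⟩
  · intro α β h
    refine Finset.sum_eq_zero fun e he' => ?_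
    obtain ⟨he, h1⟩ := Finset.mem_filter.1 he'
    have := hA e he
    rw [h1] at this
    exact absurd this (not_le.2 h)
  · intro x y
    have hev : MvPolynomial.eval (Sum.elim (fun j => x j) (fun j => y j)) P =
        ∑ s ∈ Finset.range (q + 1), c s * ‖x - y‖ ^ (2 * s) := by
      simp only [P, map_sum, map_mul, MvPolynomial.eval_C, map_pow, map_sub, MvPolynomial.eval_X,
        Sum.elim_inl, Sum.elim_inr]
      refine Finset.sum_congr rfl fun s _ => ?_
      rw [pow_mul, EuclideanSpace.norm_sq_eq]
      simp
    rw [← hev, MvPolynomial.eval_eq', ← Finset.sum_product']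
    have hmaps : ∀ e ∈ P.support, A e ∈ expBox d (2 * q + 1) ×ˢ expBox d (2 * q + 1) := by
      intro e he
      have h1 := hA e he
      simp only [expBox, Finset.mem_product, Fintype.mem_piFinset, Finset.mem_range]
      refine ⟨fun j => ?_, fun j => ?_⟩
      · have := Finset.single_le_sum (f := (A e).1) (fun _ _ => Nat.zero_le _) (Finset.mem_univ j)
        omega
      · have := Finset.single_le_sum (f := (A e).2) (fun _ _ => Nat.zero_le _) (Finset.mem_univ j)
        omega
    rw [← Finset.sum_fiberwise_of_maps_to hmaps]
    refine Finset.sum_congr rfl fun ab _ => ?_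
    rw [mul_assoc, Finset.sum_mul]
    refine Finset.sum_congr rfl fun e he => ?_
    have h1 : A e = ab := (Finset.mem_filter.1 he).2
    rw [← h1, Fintype.prod_sum_type]
    simp [monom, A]

/-- The exponent function of a multi-index. -/
def MultiIndex.exp {k : ℕ} (α : MultiIndex d k) : Fin d → ℕ := fun j => (α.1 j : ℕ)

theorem MultiIndex.sum_exp_le {k : ℕ} (α : MultiIndex d k) : ∑ j, α.exp j ≤ k := α.2

theorem MultiIndex.exp_injective {k : ℕ} :
    Function.Injective (MultiIndex.exp : MultiIndex d k → Fin d → ℕ) := by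
  intro α β h
  exact Subtype.ext (funext fun j => Fin.ext (congrFun h j))

theorem MultiIndex.exists_exp_eq {k : ℕ} {α : Fin d → ℕ} (h : ∑ j, α j ≤ k) :
    ∃ β : MultiIndex d k, β.exp = α := by
  have hj : ∀ j, α j ≤ k := fun j =>
    (Finset.single_le_sum (f := α) (fun _ _ => Nat.zero_le _) (Finset.mem_univ j)).trans h
  exact ⟨⟨fun j => ⟨α j, Nat.lt_succ_of_le (hj j)⟩, h⟩, rfl⟩

theorem vandermondeLE_apply {n k : ℕ} (x : Fin n → E d) (i : Fin n) (α : MultiIndex d k) :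
    vandermondeLE x k i α = monom α.exp (x i) := rfl

theorem sum_expBox_eq {k N : ℕ} (hN : k < N) (F : (Fin d → ℕ) → ℝ) :
    ∑ α ∈ expBox d N, F α = ∑ α : MultiIndex d k, F α.exp +
      ∑ α ∈ (expBox d N).filter (fun α => k < ∑ j, α j), F α := by
  classical
  rw [← Finset.sum_filter_add_sum_filter_not (expBox d N) (fun α => ∑ j, α j ≤ k)]
  simp only [not_le]
  congr 1
  rw [← Finset.sum_image (f := F) (s := Finset.univ)
    (fun a _ b _ h => MultiIndex.exp_injective h)]
  refine Finset.sum_congr ?_ fun _ _ => rfl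
  ext α
  simp only [Finset.mem_filter, Finset.mem_image, Finset.mem_univ, true_and]
  constructor
  · rintro ⟨-, h⟩
    exact MultiIndex.exists_exp_eq h
  · rintro ⟨β, rfl⟩
    refine ⟨?_, β.sum_exp_le⟩
    simp only [expBox, Fintype.mem_piFinset, Finset.mem_range]
    intro j
    exact lt_of_lt_of_le (β.1 j).2 hN

/-- Stars and bars: the slack `k - |α|`, added as an extra coordinate, makes the total degree
exactly `k`. -/
theorem card_multiIndex_le (d k : ℕ) : Fintype.card (MultiIndex d k) ≤ polyDim k d := by
  classical
  have h1 : (Finset.piAntidiag (Finset.univ : Finset (Fin (d + 1))) k).card = (k + d).choose d := by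
    rw [← Finset.map_sym_eq_piAntidiag, Finset.card_map, Finset.sym_univ, Finset.card_univ,
      Sym.card_sym_eq_choose, Fintype.card_fin]
    rw [show d + 1 + k - 1 = k + d by omega, ← Nat.choose_symm (Nat.le_add_left d k)]
    congr 1
    omega
  rw [polyDim, ← h1, ← Finset.card_univ]
  refine Finset.card_le_card_of_injOn
    (fun α => (Fin.cons (k - ∑ j, α.exp j) α.exp : Fin (d + 1) → ℕ)) ?_ ?_
  · intro α _
    simp only [Finset.mem_coe, Finset.mem_piAntidiag, Finset.mem_univ, implies_true, and_true]
    rw [Fin.sum_univ_succ]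
    simp only [Fin.cons_zero, Fin.cons_succ]
    exact Nat.sub_add_cancel α.sum_exp_le
  · intro α _ β _ h
    refine MultiIndex.exp_injective (funext fun j => ?_)
    simpa using congrFun h j.succ

end Monomials

/-! ### Expansion of `t ^ p * |t|` with a uniform remainder. -/

section OddPowers

open MeasureTheory

/-- The function `t ^ p * |t|`. -/
def oddAbs (p : ℕ) (t : ℝ) : ℝ := t ^ p * |t|

theorem continuous_oddAbs (p : ℕ) : Continuous (oddAbs p) := by
  unfold oddAbs; fun_prop

theorem oddAbs_mul (p : ℕ) (s t : ℝ) : oddAbs p (s * t) = oddAbs p s * oddAbs p t := by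
  simp only [oddAbs, mul_pow, abs_mul]; ring

theorem oddAbs_two_mul (q : ℕ) (t : ℝ) : oddAbs (2 * q) t = |t| ^ (2 * q + 1) := by
  rw [oddAbs, pow_succ, pow_mul, pow_mul, sq_abs]

theorem oddAbs_of_nonneg (p : ℕ) {t : ℝ} (ht : 0 ≤ t) : oddAbs p t = t ^ (p + 1) := by
  rw [oddAbs, abs_of_nonneg ht, pow_succ]

theorem oddAbs_of_nonpos (p : ℕ) {t : ℝ} (ht : t ≤ 0) : oddAbs p t = -t ^ (p + 1) := by
  rw [oddAbs, abs_of_nonpos ht, pow_succ]; ring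

theorem sum_choose_mul_pow (p : ℕ) (s h : ℝ) :
    ∑ l ∈ Finset.range (p + 1), ((p + 1).choose l : ℝ) * h ^ l * s ^ (p - l + 1) =
      (s + h) ^ (p + 1) - h ^ (p + 1) := by
  rw [add_comm s h, add_pow, Finset.sum_range_succ _ (p + 1)]
  simp only [Nat.sub_self, pow_zero, mul_one, Nat.choose_self, Nat.cast_one, add_sub_cancel_right]
  refine Finset.sum_congr rfl fun l hl => ?_
  have := Finset.mem_range.1 hl
  rw [show p + 1 - l = p - l + 1 by omega]
  ring

/-- The sum is `± ((s + h)^(p+1) - h^(p+1))` with the sign of `s`. If `s + h` has the same sign, the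
error is `|h|^(p+1)`. Otherwise `|s + h| ≤ |h|`, which accounts for the constant `3`. The bound
needs no smallness of `h`, so it can be integrated over directions. -/
theorem abs_oddAbs_add_sub_le (p : ℕ) (s h : ℝ) :
    |oddAbs p (s + h) - ∑ l ∈ Finset.range (p + 1),
      ((p + 1).choose l : ℝ) * h ^ l * oddAbs (p - l) s| ≤ 3 * |h| ^ (p + 1) := by
  have hpow : ∀ {a : ℝ}, |a| ≤ |h| → |a ^ (p + 1)| ≤ |h| ^ (p + 1) := fun {a} ha => by
    rw [abs_pow]; exact pow_le_pow_left₀ (abs_nonneg _) ha _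
  have hh := abs_le.1 (hpow (le_refl |h|))
  rcases le_total 0 s with hs | hs
  · simp only [oddAbs_of_nonneg _ hs, sum_choose_mul_pow]
    rcases le_total 0 (s + h) with hsh | hsh
    · rw [oddAbs_of_nonneg _ hsh, abs_le]
      constructor <;> linarith
    · have h1 := abs_le.1 (hpow (a := s + h) (by
        rw [abs_of_nonpos hsh, abs_of_nonpos (by linarith)]; linarith))
      rw [oddAbs_of_nonpos _ hsh, abs_le]
      constructor <;> linarith
  · simp only [oddAbs_of_nonpos _ hs, mul_neg, Finset.sum_neg_distrib, sum_choose_mul_pow]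
    rcases le_total (s + h) 0 with hsh | hsh
    · rw [oddAbs_of_nonpos _ hsh, abs_le]
      constructor <;> linarith
    · have h1 := abs_le.1 (hpow (a := s + h) (by
        rw [abs_of_nonneg hsh, abs_of_nonneg (by linarith)]; linarith))
      rw [oddAbs_of_nonneg _ hsh, abs_le]
      constructor <;> linarith

theorem abs_sum_mul_oddAbs_sub_le {ι : Type*} [Fintype ι] {p k : ℕ} (hk : k ≤ p) {a t : ι → ℝ}
    (h : ∀ l ≤ p, l ≠ k → ∑ i, a i * t i ^ l = 0) (s δ : ℝ) :
    |∑ i, a i * oddAbs p (s - δ * t i) -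
      ((p + 1).choose k : ℝ) * (-δ) ^ k * ((∑ i, a i * t i ^ k) * oddAbs (p - k) s)| ≤
      |δ| ^ (p + 1) * (3 * ∑ i, |a i| * |t i| ^ (p + 1)) := by
  have h1 : ((p + 1).choose k : ℝ) * (-δ) ^ k * ((∑ i, a i * t i ^ k) * oddAbs (p - k) s) =
      ∑ i, a i * ∑ l ∈ Finset.range (p + 1),
        ((p + 1).choose l : ℝ) * (-(δ * t i)) ^ l * oddAbs (p - l) s := by
    simp only [Finset.mul_sum]
    rw [Finset.sum_comm, Finset.sum_eq_single_of_mem k (Finset.mem_range.2 (by omega))]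
    · simp only [Finset.sum_mul, Finset.mul_sum, neg_eq_neg_one_mul (δ * _),
        neg_eq_neg_one_mul δ, mul_pow]
      exact Finset.sum_congr rfl fun i _ => by ring
    · intro l hl hne
      have h2 := h l (by have := Finset.mem_range.1 hl; omega) hne
      calc ∑ i, a i * (((p + 1).choose l : ℝ) * (-(δ * t i)) ^ l * oddAbs (p - l) s)
          = (∑ i, a i * t i ^ l) * (((p + 1).choose l : ℝ) * (-δ) ^ l * oddAbs (p - l) s) := by
            rw [Finset.sum_mul]
            refine Finset.sum_congr rfl fun i _ => ?_
            rw [← neg_mul, mul_pow]; ring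
        _ = 0 := by rw [h2, zero_mul]
  rw [h1, ← Finset.sum_sub_distrib]
  refine (Finset.abs_sum_le_sum_abs _ _).trans ?_
  simp only [Finset.mul_sum]
  refine Finset.sum_le_sum fun i _ => ?_
  rw [← Finset.mul_sum, ← mul_sub, abs_mul, sub_eq_add_neg s]
  have h3 := abs_oddAbs_add_sub_le p s (-(δ * t i))
  rw [abs_neg, abs_mul, mul_pow] at h3
  calc |a i| * _ ≤ |a i| * (3 * (|δ| ^ (p + 1) * |t i| ^ (p + 1))) :=
        mul_le_mul_of_nonneg_left h3 (abs_nonneg _)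
    _ = _ := by ring

variable {d : ℕ}

/-- Weights with only degree-`k` moments act like a homogeneous differential operator of order `k`.
The constant is uniform in `w` and `δ`; the factor `ρ` allows the operator to be applied a second
time. -/
theorem exists_bound_integral_oddAbs {ι : Type*} [Fintype ι] {p k : ℕ} (hk : k ≤ p)
    {a : ι → ℝ} {Y : ι → E d}
    (h : ∀ α : Fin d → ℕ, ∑ j, α j ≤ p → ∑ j, α j ≠ k → ∑ i, a i * monom α (Y i) = 0)
    {ρ : E d → ℝ} (hρ : Continuous ρ) :
    ∃ C : ℝ, 0 ≤ C ∧ ∀ (w : E d) (δ : ℝ),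
      |∑ i, a i * (∫ g in Metric.closedBall 0 1, ρ g * oddAbs p (inner ℝ g (w - δ • Y i))) -
        ((p + 1).choose k : ℝ) * (-δ) ^ k * ∫ g in Metric.closedBall 0 1,
          ρ g * ((∑ i, a i * inner ℝ g (Y i) ^ k) * oddAbs (p - k) (inner ℝ g w))| ≤
        |δ| ^ (p + 1) * C := by
  have hco := continuous_oddAbs
  let B : E d → ℝ := fun g => |ρ g| * (3 * ∑ i, |a i| * |inner ℝ g (Y i)| ^ (p + 1))
  have hBc : Continuous B := by fun_prop
  refine ⟨∫ g in Metric.closedBall 0 1, B g, integral_nonneg fun g => by positivity,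
    fun w δ => ?_⟩
  have hc1 : ∀ i, Continuous fun g : E d => ρ g * oddAbs p (inner ℝ g (w - δ • Y i)) := fun i =>
    hρ.mul ((hco p).comp (by fun_prop))
  have hc2 : Continuous fun g : E d =>
      ρ g * ((∑ i, a i * inner ℝ g (Y i) ^ k) * oddAbs (p - k) (inner ℝ g w)) :=
    hρ.mul ((by fun_prop : Continuous fun g : E d => ∑ i, a i * inner ℝ g (Y i) ^ k).mul
      ((hco (p - k)).comp (by fun_prop)))
  simp only [← integral_const_mul]
  rw [← integral_finsetSum _ fun i _ => (integrableOn_unitBall (hc1 i)).const_mul (a i),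
    ← integral_sub (integrable_finsetSum _ fun i _ =>
      (integrableOn_unitBall (hc1 i)).const_mul (a i))
      ((integrableOn_unitBall hc2).const_mul _), ← Real.norm_eq_abs]
  refine norm_integral_le_of_norm_le ((integrableOn_unitBall hBc).const_mul (|δ| ^ (p + 1)))
    (Eventually.of_forall fun g => ?_)
  have h1 := abs_sum_mul_oddAbs_sub_le hk (a := a) (t := fun i => inner ℝ g (Y i))
    (fun l hl hne => sum_mul_inner_pow_eq_zero
      (fun α hα => h α (hα ▸ hl) (hα ▸ hne)) g) (inner ℝ g w) δ
  have h2 : ∑ i, a i * (ρ g * oddAbs p (inner ℝ g (w - δ • Y i))) -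
      ((p + 1).choose k : ℝ) * (-δ) ^ k *
        (ρ g * ((∑ i, a i * inner ℝ g (Y i) ^ k) * oddAbs (p - k) (inner ℝ g w))) =
      ρ g * (∑ i, a i * oddAbs p (inner ℝ g w - δ * inner ℝ g (Y i)) -
      ((p + 1).choose k : ℝ) * (-δ) ^ k *
        ((∑ i, a i * inner ℝ g (Y i) ^ k) * oddAbs (p - k) (inner ℝ g w))) := by
    simp only [inner_sub_right, inner_smul_right, mul_sub, Finset.mul_sum]
    congr 1
    · exact Finset.sum_congr rfl fun i _ => by ring
    · ring
  rw [h2, Real.norm_eq_abs, abs_mul]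
  calc _ ≤ |ρ g| * _ := mul_le_mul_of_nonneg_left h1 (abs_nonneg _)
    _ = _ := by simp only [B]; ring

theorem sum_choose_mul_pow_eq_zero (M l : ℕ) (hl : l < M) :
    ∑ j : Fin (M + 1), ((-1 : ℝ) ^ (M - (j : ℕ)) * M.choose j) * ((j : ℝ) - 1) ^ l = 0 := by
  have h := congrFun (fwdDiff_iter_pow_eq_zero_of_lt (R := ℝ) hl) (-1)
  rw [fwdDiff_iter_eq_sum_shift, Finset.sum_range] at h
  rw [← (show (0 : ℝ → ℝ) (-1) = 0 from rfl), ← h]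
  refine Finset.sum_congr rfl fun j _ => ?_
  simp only [zsmul_eq_mul, nsmul_eq_mul, mul_one]
  push_cast
  congr 2
  ring

/-- Finite differences based at `-1` detect that `t ^ p * |t|` is not a polynomial. -/
theorem sum_choose_mul_oddAbs_ne_zero (M p : ℕ) (hp : p + 1 < M) :
    ∑ j : Fin (M + 1), ((-1 : ℝ) ^ (M - (j : ℕ)) * M.choose j) * oddAbs p ((j : ℝ) - 1) ≠ 0 := by
  have h0 := sum_choose_mul_pow_eq_zero M (p + 1) hp
  -- The node `j = 0` is the only negative one, so it alone departs from the polynomial that the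
  -- finite difference annihilates.
  have h1 : ∀ j : Fin (M + 1), oddAbs p ((j : ℝ) - 1) = ((j : ℝ) - 1) ^ (p + 1) +
      if j = 0 then -2 * (-1) ^ (p + 1) else 0 := by
    intro j
    rcases Nat.eq_zero_or_pos (j : ℕ) with hj | hj
    · have : j = 0 := Fin.ext hj
      subst this
      rw [oddAbs_of_nonpos _ (by simp)]
      simp; ring
    · have hj' : j ≠ 0 := fun h => by simp [h] at hj
      have : (1 : ℝ) ≤ (j : ℕ) := by exact_mod_cast hj
      rw [oddAbs_of_nonneg _ (by linarith)]
      simp [hj']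
  simp only [h1, mul_add, Finset.sum_add_distrib, h0, zero_add, mul_ite, mul_zero]
  simp

theorem eq_zero_of_sq_le {X M : ℝ} (h : ∀ δ : ℝ, 0 < δ → δ ≤ 1 → X ^ 2 ≤ δ * M) : X = 0 := by
  have h1 : Tendsto (fun δ : ℝ => δ * M) (𝓝[>] 0) (𝓝 (0 * M)) :=
    (tendsto_id.mul_const M).mono_left nhdsWithin_le_nhds
  have h2 : X ^ 2 ≤ 0 * M := ge_of_tendsto h1 (by
    filter_upwards [Ioc_mem_nhdsGT (zero_lt_one (α := ℝ))] with δ hδ using h δ hδ.1 hδ.2)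
  rw [zero_mul] at h2
  exact pow_eq_zero_iff two_ne_zero |>.1 (le_antisymm h2 (sq_nonneg _))

end OddPowers

/-! ### Odd powers of the norm detect leading moments. -/

section Nondegeneracy

open MeasureTheory

variable {d : ℕ}

theorem eq_zero_of_sum_multinomial_monom_eq_zero (hd : 1 ≤ d) {k : ℕ} {v : (Fin d → ℕ) → ℝ}
    (h : ∀ g : E d, g ≠ 0 → ∑ α ∈ Finset.piAntidiag Finset.univ k,
      (Nat.multinomial Finset.univ α : ℝ) * monom α g * v α = 0)
    {α : Fin d → ℕ} (hα : ∑ j, α j = k) : v α = 0 := by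
  classical
  let F : (Fin d → ℕ) → (Fin d →₀ ℕ) := Finsupp.equivFunOnFinite.symm
  let P : MvPolynomial (Fin d) ℝ := ∑ α ∈ Finset.piAntidiag Finset.univ k,
    MvPolynomial.monomial (F α) ((Nat.multinomial Finset.univ α : ℝ) * v α)
  have hP : ∀ g : Fin d → ℝ, MvPolynomial.eval g P = ∑ α ∈ Finset.piAntidiag Finset.univ k,
      (Nat.multinomial Finset.univ α : ℝ) * monom α (WithLp.toLp 2 g) * v α := by
    intro g
    simp only [P, map_sum, MvPolynomial.eval_monomial]
    refine Finset.sum_congr rfl fun α _ => ?_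
    rw [Finsupp.prod_fintype _ _ (fun _ => pow_zero _)]
    simp only [F, monom, Finsupp.equivFunOnFinite_symm_apply_apply]
    ring
  -- Multiplying by a variable removes the excluded point `g = 0`.
  have h0 : MvPolynomial.X ⟨0, hd⟩ * P = 0 := by
    refine MvPolynomial.funext fun g => ?_
    rw [map_mul, MvPolynomial.eval_X, map_zero]
    by_cases hg : g = 0
    · simp [hg]
    · rw [hP, h _ (fun h1 => hg ?_), mul_zero]
      simpa using congrArg (WithLp.ofLp) h1
  have hP0 : P = 0 := (mul_eq_zero.1 h0).resolve_left (MvPolynomial.X_ne_zero _)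
  have h1 := congrArg (MvPolynomial.coeff (F α)) hP0
  simp only [P, MvPolynomial.coeff_sum, MvPolynomial.coeff_monomial, MvPolynomial.coeff_zero,
    F, Equiv.apply_eq_iff_eq] at h1
  rw [Finset.sum_ite_eq' _ _ _, if_pos (by simpa using hα)] at h1
  exact (mul_eq_zero.1 h1).resolve_left
    (by exact_mod_cast (Nat.multinomial_pos _ _).ne')

theorem sq_le_mul_of_quadratic_nonneg {A T B : ℝ} (h : ∀ s : ℝ, 0 ≤ A + 2 * s * T + s ^ 2 * B) :
    T ^ 2 ≤ A * B := by
  have h1 : ∀ s : ℝ, 0 ≤ B * (s * s) + 2 * T * s + A := fun s => by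
    have := h s; linarith
  have := discrim_le_zero h1
  rw [discrim] at this
  linarith

theorem sum_sum_elim {ι κ : Type*} [Fintype ι] [Fintype κ] (a : ι → ℝ) (b : κ → ℝ) (P : ι → E d)
    (Q : κ → E d) (N : ℕ) :
    ∑ i, ∑ j, Sum.elim a b i * Sum.elim a b j * ‖Sum.elim P Q i - Sum.elim P Q j‖ ^ N =
      ∑ i, ∑ j, a i * a j * ‖P i - P j‖ ^ N + 2 * ∑ i, ∑ j, a i * b j * ‖Q j - P i‖ ^ N +
        ∑ i, ∑ j, b i * b j * ‖Q i - Q j‖ ^ N := by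
  simp only [Fintype.sum_sum_type, Sum.elim_inl, Sum.elim_inr, Finset.sum_add_distrib]
  have h1 : ∑ i, ∑ j, b i * a j * ‖Q i - P j‖ ^ N = ∑ i, ∑ j, a i * b j * ‖Q j - P i‖ ^ N := by
    rw [Finset.sum_comm]
    exact Finset.sum_congr rfl fun i _ => Finset.sum_congr rfl fun j _ => by ring
  have h2 : ∑ i, ∑ j, a i * b j * ‖P i - Q j‖ ^ N = ∑ i, ∑ j, a i * b j * ‖Q j - P i‖ ^ N :=
    Finset.sum_congr rfl fun i _ => Finset.sum_congr rfl fun j _ => by rw [norm_sub_rev]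
  rw [h1, h2]
  ring

/-- If the form `c ‖x - y‖^(2q+1)` is nonnegative on all weights whose moments up to order `2q` are
proportional to a vector `v` of homogeneous degree `k ≤ q`, then `v = 0`. -/
theorem moments_eq_zero_of_nonneg (hd : 1 ≤ d) {q k : ℕ} (hk : k ≤ q) {c : ℝ} (hc : c ≠ 0)
    {v : (Fin d → ℕ) → ℝ}
    (hpos : ∀ (ι : Type) [Fintype ι] (p : ι → E d) (e : ι → ℝ) (t : ℝ),
      (∀ α : Fin d → ℕ, ∑ j, α j ≤ 2 * q →
        ∑ i, e i * monom α (p i) = if ∑ j, α j = k then t * v α else 0) →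
      0 ≤ c * ∑ i, ∑ j, e i * e j * ‖p i - p j‖ ^ (2 * q + 1))
    {α : Fin d → ℕ} (hα : ∑ j, α j = k) : v α = 0 := by
  obtain ⟨Y, hY⟩ := exists_grid_moments d (2 * q)
  obtain ⟨a, ha'⟩ := hY fun α => if ∑ j, α j = k then v α else 0
  have ha : ∀ α : Fin d → ℕ, ∑ j, α j ≤ 2 * q →
      ∑ y, a y * monom α (Y y) = if ∑ j, α j = k then v α else 0 := fun α h =>
    ha' α fun j => (Finset.single_le_sum (f := α) (fun _ _ => Nat.zero_le _)
      (Finset.mem_univ j)).trans h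
  clear ha' hY
  obtain ⟨c₀, hc₀, hInt⟩ := exists_integral_abs_inner_pow hd (2 * q + 1)
  let π : E d → ℝ := fun g => ∑ y, a y * inner ℝ g (Y y) ^ k
  have hπc : Continuous π := by fun_prop
  let H : E d → ℝ := fun w =>
    ∫ g in Metric.closedBall 0 1, π g * oddAbs (2 * q - k) (inner ℝ g w)
  -- `H` is, up to a constant, what the weights `a` leave of `‖w‖^(2q+1)` at order `δ^k`. It is
  -- tested against a finite difference along the line of `w`, whose weights `b` have no moments up
  -- to order `2q`.
  have hH : ∀ w, H w = 0 := by
    intro w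
    let b : Fin (2 * q + 2 + 1) → ℝ := fun j =>
      (-1 : ℝ) ^ (2 * q + 2 - (j : ℕ)) * (2 * q + 2).choose j
    let z : Fin (2 * q + 2 + 1) → E d := fun j => ((j : ℝ) - 1) • w
    have hb : ∀ α : Fin d → ℕ, ∑ j, α j ≤ 2 * q → ∑ j, b j * monom α (z j) = 0 := by
      intro α hα
      simp only [z, monom_smul, ← mul_assoc, ← Finset.sum_mul]
      rw [sum_choose_mul_pow_eq_zero _ _ (by omega), zero_mul]
    let Sa : ℝ := ∑ i, ∑ j, a i * a j * ‖Y i - Y j‖ ^ (2 * q + 1)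
    let Sb : ℝ := ∑ i, ∑ j, b i * b j * ‖z i - z j‖ ^ (2 * q + 1)
    let T : ℝ → ℝ := fun δ => ∑ i, ∑ j, a i * b j * ‖z j - δ • Y i‖ ^ (2 * q + 1)
    -- Cauchy–Schwarz: adding any multiple `s b` leaves the relevant moments unchanged, so the form
    -- is a nonnegative quadratic in `s`.
    have hCS : ∀ δ : ℝ, 0 < δ → T δ ^ 2 ≤ δ ^ (2 * q + 1) * (Sa * Sb) := by
      intro δ hδ
      have h1 : ∀ s : ℝ, 0 ≤ c * (δ ^ (2 * q + 1) * Sa) + 2 * s * (c * T δ) +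
          s ^ 2 * (c * Sb) := by
        intro s
        have h2 := hpos _ (Sum.elim (fun y => δ • Y y) z) (Sum.elim a (fun j => s * b j)) (δ ^ k) ?_
        · rw [sum_sum_elim] at h2
          have h3 : ∑ i, ∑ j, a i * a j * ‖δ • Y i - δ • Y j‖ ^ (2 * q + 1) =
              δ ^ (2 * q + 1) * Sa := by
            simp only [← smul_sub, norm_smul, Real.norm_of_nonneg hδ.le, mul_pow, Sa,
              Finset.mul_sum]
            exact Finset.sum_congr rfl fun i _ => Finset.sum_congr rfl fun j _ => by ring
          have h4 : ∑ i, ∑ j, a i * (s * b j) * ‖z j - δ • Y i‖ ^ (2 * q + 1) = s * T δ := by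
            simp only [T, Finset.mul_sum]
            exact Finset.sum_congr rfl fun i _ => Finset.sum_congr rfl fun j _ => by ring
          have h5 : ∑ i, ∑ j, s * b i * (s * b j) * ‖z i - z j‖ ^ (2 * q + 1) = s ^ 2 * Sb := by
            simp only [Sb, Finset.mul_sum]
            exact Finset.sum_congr rfl fun i _ => Finset.sum_congr rfl fun j _ => by ring
          rw [h3, h4, h5] at h2
          linarith
        · intro α hα
          simp only [Fintype.sum_sum_type, Sum.elim_inl, Sum.elim_inr, mul_assoc,
            ← Finset.mul_sum, hb α hα, mul_zero, add_zero, monom_smul]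
          simp only [mul_left_comm _ (δ ^ _), ← Finset.mul_sum, ha α hα]
          split_ifs with h
          · rw [h]
          · simp
      have h2 := sq_le_mul_of_quadratic_nonneg h1
      have h3 : 0 < c ^ 2 := by positivity
      refine le_of_mul_le_mul_left ?_ h3
      calc c ^ 2 * T δ ^ 2 = (c * T δ) ^ 2 := by ring
        _ ≤ _ := h2
        _ = _ := by ring
    obtain ⟨C, hC0, hC⟩ := exists_bound_integral_oddAbs (p := 2 * q) (k := k) (by omega) (a := a)
      (Y := Y) (fun α h1 h2 => by rw [ha α h1, if_neg h2]) (ρ := fun _ => 1) continuous_const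
    let N : ℝ := ∑ j, b j * oddAbs (2 * q - k) ((j : ℝ) - 1)
    have hN : N ≠ 0 := sum_choose_mul_oddAbs_ne_zero (2 * q + 2) (2 * q - k) (by omega)
    let X : ℝ := ((2 * q + 1).choose k : ℝ) * N * H w
    let Cb : ℝ := C * ∑ j, |b j|
    have hT : ∀ δ : ℝ, |c₀ * T δ - (-δ) ^ k * X| ≤ |δ| ^ (2 * q + 1) * Cb := by
      intro δ
      have h1 : c₀ * T δ - (-δ) ^ k * X = ∑ j, b j *
          (∑ i, a i * (∫ g in Metric.closedBall 0 1,
              1 * oddAbs (2 * q) (inner ℝ g (z j - δ • Y i))) -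
            ((2 * q + 1).choose k : ℝ) * (-δ) ^ k * ∫ g in Metric.closedBall 0 1,
              1 * ((∑ i, a i * inner ℝ g (Y i) ^ k) * oddAbs (2 * q - k) (inner ℝ g (z j)))) := by
        have h2 : ∀ j, ∫ g in Metric.closedBall 0 1,
            1 * ((∑ i, a i * inner ℝ g (Y i) ^ k) * oddAbs (2 * q - k) (inner ℝ g (z j))) =
            oddAbs (2 * q - k) ((j : ℝ) - 1) * H w := by
          intro j
          rw [← integral_const_mul]
          refine integral_congr_ae (Eventually.of_forall fun g => ?_)
          simp only [z, inner_smul_right, oddAbs_mul, π]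
          ring
        simp only [h2]
        simp only [one_mul, oddAbs_two_mul, hInt, mul_sub, Finset.sum_sub_distrib]
        congr 1
        · simp only [T, Finset.mul_sum]
          rw [Finset.sum_comm]
          exact Finset.sum_congr rfl fun i _ => Finset.sum_congr rfl fun j _ => by ring
        · simp only [X, N, Finset.mul_sum, Finset.sum_mul]
          exact Finset.sum_congr rfl fun i _ => by ring
      rw [h1]
      refine (Finset.abs_sum_le_sum_abs _ _).trans ?_
      simp only [Cb, Finset.mul_sum]
      refine Finset.sum_le_sum fun j _ => ?_
      rw [abs_mul]
      calc |b j| * _ ≤ |b j| * (|δ| ^ (2 * q + 1) * C) :=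
            mul_le_mul_of_nonneg_left (hC (z j) δ) (abs_nonneg _)
        _ = _ := by ring
    -- The cross term is `δ^k X + O(δ^(2q+1))` up to sign and the factor `c₀`, while its square is
    -- `O(δ^(2q+1))`. As `2k ≤ 2q`, dividing by `δ^(2q)` and letting `δ → 0` leaves `X = 0`.
    have hX : X = 0 := by
      refine eq_zero_of_sq_le (M := 2 * c₀ ^ 2 * (Sa * Sb) + 2 * Cb ^ 2) fun δ hδ hδ1 => ?_
      have h1 := hT δ
      have h2 := hCS δ hδ
      rw [abs_of_pos hδ] at h1
      have h3 : ((-δ) ^ k * X) ^ 2 ≤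
          2 * (c₀ * T δ) ^ 2 + 2 * (δ ^ (2 * q + 1) * Cb) ^ 2 := by
        have h4 := sq_le_sq' (abs_le.1 h1).1 (abs_le.1 h1).2
        nlinarith [sq_nonneg (2 * (c₀ * T δ) - (-δ) ^ k * X)]
      have h5 : δ ^ (2 * q + 1) * δ ^ (2 * q + 1) ≤ δ ^ (2 * q + 1) * 1 :=
        mul_le_mul_of_nonneg_left (pow_le_one₀ hδ.le hδ1) (by positivity)
      have h6 : ((-δ) ^ k * X) ^ 2 = δ ^ (2 * k) * X ^ 2 := by
        rw [mul_pow, ← pow_mul, mul_comm k 2, Even.neg_pow (even_two_mul k)]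
      have h7 : δ ^ (2 * q) * X ^ 2 ≤ δ ^ (2 * k) * X ^ 2 :=
        mul_le_mul_of_nonneg_right (pow_le_pow_of_le_one hδ.le hδ1 (by omega)) (sq_nonneg _)
      have h8 : δ ^ (2 * q) * X ^ 2 ≤
          δ ^ (2 * q) * (δ * (2 * c₀ ^ 2 * (Sa * Sb) + 2 * Cb ^ 2)) := by
        calc δ ^ (2 * q) * X ^ 2 ≤ 2 * (c₀ * T δ) ^ 2 + 2 * (δ ^ (2 * q + 1) * Cb) ^ 2 := by
              rw [← h6] at h7; exact h7.trans h3
          _ = 2 * c₀ ^ 2 * T δ ^ 2 + 2 * Cb ^ 2 * (δ ^ (2 * q + 1) * δ ^ (2 * q + 1)) := by ring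
          _ ≤ 2 * c₀ ^ 2 * (δ ^ (2 * q + 1) * (Sa * Sb)) +
              2 * Cb ^ 2 * (δ ^ (2 * q + 1) * 1) := by gcongr
          _ = _ := by ring
      exact le_of_mul_le_mul_left h8 (by positivity)
    have hch : ((2 * q + 1).choose k : ℝ) ≠ 0 := by
      exact_mod_cast (Nat.choose_pos (by omega)).ne'
    exact (mul_eq_zero.1 hX).resolve_left (mul_ne_zero hch hN)
  -- Applying the weights `a` once more, to `H = 0`, produces a second factor `π`. The integrand
  -- becomes `π g ^ 2 * |⟨g, w⟩| ^ (2 * (q - k) + 1)`, which is nonnegative, so `π` must vanish.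
  have hsq : ∀ w : E d, ∫ g in Metric.closedBall 0 1,
      π g * (π g * oddAbs (2 * q - k - k) (inner ℝ g w)) = 0 := by
    intro w
    obtain ⟨C, hC0, hC⟩ := exists_bound_integral_oddAbs (p := 2 * q - k) (k := k) (by omega)
      (a := a) (Y := Y) (fun α h1 h2 => by rw [ha α (by omega), if_neg h2]) hπc
    set X : ℝ := ∫ g in Metric.closedBall 0 1,
      π g * (π g * oddAbs (2 * q - k - k) (inner ℝ g w)) with hXdef
    have hch : ((2 * q - k + 1).choose k : ℝ) ≠ 0 := by
      exact_mod_cast (Nat.choose_pos (by omega)).ne'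
    have hX : ((2 * q - k + 1).choose k : ℝ) * X = 0 := by
      refine eq_zero_of_sq_le (M := C ^ 2) fun δ hδ hδ1 => ?_
      have h1 := hC w δ
      have h2 : ∀ y, ∫ g in Metric.closedBall 0 1,
          π g * oddAbs (2 * q - k) (inner ℝ g (w - δ • Y y)) = 0 := fun y => hH _
      simp only [h2, mul_zero, Finset.sum_const_zero, zero_sub, abs_neg] at h1
      change |((2 * q - k + 1).choose k : ℝ) * (-δ) ^ k * X| ≤ _ at h1
      rw [mul_right_comm, abs_mul, abs_pow, abs_neg, abs_of_pos hδ] at h1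
      have h3 : δ ^ (2 * q - k + 1) ≤ δ ^ (k + 1) :=
        pow_le_pow_of_le_one hδ.le hδ1 (by omega)
      have h4 : δ ^ k * |((2 * q - k + 1).choose k : ℝ) * X| ≤ δ ^ k * (δ * C) := by
        calc _ = _ := mul_comm _ _
          _ ≤ _ := h1
          _ ≤ δ ^ (k + 1) * C := mul_le_mul_of_nonneg_right h3 hC0
          _ = _ := by ring
      have h5 := le_of_mul_le_mul_left h4 (by positivity)
      calc _ = |((2 * q - k + 1).choose k : ℝ) * X| ^ 2 := (sq_abs _).symm
        _ ≤ (δ * C) ^ 2 := pow_le_pow_left₀ (abs_nonneg _) h5 2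
        _ = δ * δ * C ^ 2 := by ring
        _ ≤ δ * 1 * C ^ 2 := by gcongr
        _ = _ := by ring
    exact (mul_eq_zero.1 hX).resolve_left hch
  have hπ : ∀ g : E d, ‖g‖ < 1 → g ≠ 0 → π g = 0 := by
    intro g hg hg0
    have h1 : ∀ g' w : E d, π g' * (π g' * oddAbs (2 * q - k - k) (inner ℝ g' w)) =
        π g' ^ 2 * |inner ℝ g' w| ^ (2 * (q - k) + 1) := by
      intro g' w
      rw [show 2 * q - k - k = 2 * (q - k) by omega, oddAbs_two_mul]
      ring
    have h2 := hsq g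
    simp only [h1] at h2
    have h3 := eq_zero_of_integral_unitBall_eq_zero (by fun_prop) (fun g => by positivity) h2 hg
    have h4 : inner ℝ g g ≠ 0 := inner_self_ne_zero.2 hg0
    have h5 : |inner ℝ g g| ^ (2 * (q - k) + 1) ≠ 0 := pow_ne_zero _ (abs_ne_zero.2 h4)
    exact pow_eq_zero_iff two_ne_zero |>.1 ((mul_eq_zero.1 h3).resolve_right h5)
  refine eq_zero_of_sum_multinomial_monom_eq_zero hd (k := k) (fun g hg0 => ?_) hα
  have h1 : π g = ∑ α ∈ Finset.piAntidiag Finset.univ k,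
      (Nat.multinomial Finset.univ α : ℝ) * monom α g * v α := by
    simp only [π]
    rw [sum_mul_inner_pow]
    refine Finset.sum_congr rfl fun α hα => ?_
    have : ∑ j, α j = k := (Finset.mem_piAntidiag.1 hα).1
    rw [ha α (by omega), if_pos this]
  rw [← h1]
  have ht : (0 : ℝ) < (‖g‖ + 1)⁻¹ := by positivity
  have h2 := hπ ((‖g‖ + 1)⁻¹ • g) (by
    rw [norm_smul, Real.norm_of_nonneg ht.le, inv_mul_lt_iff₀ (by positivity)]; linarith)
    (smul_ne_zero ht.ne' hg0)
  have h3 : π ((‖g‖ + 1)⁻¹ • g) = ((‖g‖ + 1)⁻¹) ^ k * π g := by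
    simp only [π, inner_smul_left, RCLike.conj_to_real, mul_pow, Finset.mul_sum]
    exact Finset.sum_congr rfl fun i _ => by ring
  rw [h3] at h2
  exact (mul_eq_zero.1 h2).resolve_left (pow_ne_zero _ ht.ne')

end Nondegeneracy

/-! ### Expansion of the kernel and invertibility of its low-degree coefficients. -/

section KernelExpansion

variable {d : ℕ}

theorem sum_range_two_mul (g : ℕ → ℝ) (n : ℕ) :
    ∑ i ∈ Finset.range (2 * n), g i = ∑ s ∈ Finset.range n, (g (2 * s) + g (2 * s + 1)) := by
  induction n with
  | zero => simp
  | succ n ih =>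
    rw [show 2 * (n + 1) = 2 * n + 1 + 1 by ring, Finset.sum_range_succ, Finset.sum_range_succ, ih,
      Finset.sum_range_succ]
    ring

/-- The expansion of a profile of smoothness order `q + 1` up to its first odd term. -/
theorem tendsto_profile_remainder {f : ℝ → ℝ} {q : ℕ} (hf : AnalyticAt ℝ f 0)
    (hq : HasSmoothnessOrder f (q + 1)) (ρ : ℝ) :
    Tendsto (fun τ : ℝ => (f (τ * ρ) -
      ∑ s ∈ Finset.range (q + 1), taylorCoeff f (2 * s) * (τ * ρ) ^ (2 * s)) / τ ^ (2 * q + 1))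
      (𝓝[>] 0) (𝓝 (taylorCoeff f (2 * q + 1) * ρ ^ (2 * q + 1))) := by
  have hodd : ∀ s < q, taylorCoeff f (2 * s + 1) = 0 := by
    intro s hs
    by_contra hne
    have := hq.2 (show s + 1 ∈ {s : ℕ | 1 ≤ s ∧ taylorCoeff f (2 * s - 1) ≠ 0} from
      ⟨by omega, by rwa [show 2 * (s + 1) - 1 = 2 * s + 1 by omega]⟩)
    omega
  -- This partial sum stops at degree `2q + 1`, so the remainder is one order smaller than the first
  -- odd term.
  have hO := hf.hasFPowerSeriesAt.isBigO_sub_partialSum_pow (2 * (q + 1))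
  have hps : ∀ y : ℝ, (FormalMultilinearSeries.ofScalars ℝ
      (fun n ↦ iteratedDeriv n f 0 / n.factorial)).partialSum (2 * (q + 1)) y =
      ∑ s ∈ Finset.range (q + 1), taylorCoeff f (2 * s) * y ^ (2 * s) +
        taylorCoeff f (2 * q + 1) * y ^ (2 * q + 1) := by
    intro y
    have h1 : (FormalMultilinearSeries.ofScalars ℝ
        (fun n ↦ iteratedDeriv n f 0 / n.factorial)).partialSum (2 * (q + 1)) y =
        ∑ i ∈ Finset.range (2 * (q + 1)), taylorCoeff f i * y ^ i := by
      simp [FormalMultilinearSeries.partialSum, taylorCoeff, mul_comm]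
    rw [h1, sum_range_two_mul, Finset.sum_add_distrib]
    congr 1
    rw [Finset.sum_range_succ, Finset.sum_eq_zero, zero_add]
    intro s hs
    rw [hodd s (Finset.mem_range.1 hs), zero_mul]
  simp only [hps, zero_add] at hO
  have ht : Tendsto (fun τ : ℝ => τ * ρ) (𝓝[>] 0) (𝓝 0) := by
    have : Tendsto (fun τ : ℝ => τ * ρ) (𝓝 0) (𝓝 (0 * ρ)) := tendsto_id.mul_const ρ
    rw [zero_mul] at this
    exact this.mono_left nhdsWithin_le_nhds
  obtain ⟨C, hC⟩ := (hO.comp_tendsto ht).bound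
  have hz : Tendsto (fun τ : ℝ => (f (τ * ρ) -
      (∑ s ∈ Finset.range (q + 1), taylorCoeff f (2 * s) * (τ * ρ) ^ (2 * s) +
        taylorCoeff f (2 * q + 1) * (τ * ρ) ^ (2 * q + 1))) / τ ^ (2 * q + 1)) (𝓝[>] 0) (𝓝 0) := by
    have hb : Tendsto (fun τ : ℝ => C * |ρ| ^ (2 * (q + 1)) * τ) (𝓝[>] 0) (𝓝 0) := by
      have : Tendsto (fun τ : ℝ => C * |ρ| ^ (2 * (q + 1)) * τ) (𝓝 0)
        (𝓝 (C * |ρ| ^ (2 * (q + 1)) * 0)) := tendsto_id.const_mul _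
      rw [mul_zero] at this
      exact this.mono_left nhdsWithin_le_nhds
    refine squeeze_zero_norm' ?_ hb
    filter_upwards [hC, self_mem_nhdsWithin] with τ hτ hpos
    have hpos : 0 < τ := hpos
    simp only [Function.comp_apply, norm_pow, Real.norm_eq_abs, abs_abs, abs_mul] at hτ
    rw [Real.norm_eq_abs, abs_div, abs_pow, abs_of_pos hpos, div_le_iff₀ (by positivity)]
    refine hτ.trans (le_of_eq ?_)
    rw [abs_of_pos hpos]
    ring
  have hsum := hz.add_const (taylorCoeff f (2 * q + 1) * ρ ^ (2 * q + 1))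
  rw [zero_add] at hsum
  refine hsum.congr' ?_
  filter_upwards [self_mem_nhdsWithin] with τ hpos
  have hpos : 0 < τ := hpos
  field_simp
  ring

theorem sum_sum_mul_nonneg_of_stationary {κ : E d → E d → ℝ} {f : ℝ → ℝ}
    (h : IsStationaryKernel κ f) {ι : Type*} [Fintype ι] (p : ι → E d) (e : ι → ℝ) :
    0 ≤ ∑ i, ∑ j, e i * e j * f ‖p i - p j‖ := by
  let σ := Fintype.equivFin ι
  have h1 := (h.posSemidef _ (p ∘ σ.symm)).dotProduct_mulVec_nonneg (e ∘ σ.symm)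
  simp only [dotProduct, Matrix.mulVec, star_trivial, Matrix.of_apply, Function.comp,
    h.stationary, Finset.mul_sum] at h1
  rw [← σ.symm.sum_comp]
  simp only [← σ.symm.sum_comp (fun j => e _ * e j * f ‖p _ - p j‖)]
  refine h1.trans_eq ?_
  exact Finset.sum_congr rfl fun i _ => Finset.sum_congr rfl fun j _ => by ring

/-- A null vector of the polynomial part of the kernel enlarges the space of weights on which the
first odd term is nonnegative. -/
theorem odd_form_nonneg_of_null {f : ℝ → ℝ} {q k : ℕ} {c : ℕ → ℝ} {c' : ℝ}
    (hpsd : ∀ (ι : Type) [Fintype ι] (p : ι → E d) (e : ι → ℝ),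
      0 ≤ ∑ i, ∑ j, e i * e j * f ‖p i - p j‖)
    (hf : ∀ ρ : ℝ, Tendsto (fun τ : ℝ => (f (τ * ρ) -
      ∑ s ∈ Finset.range (q + 1), c s * (τ * ρ) ^ (2 * s)) / τ ^ (2 * q + 1))
      (𝓝[>] 0) (𝓝 (c' * ρ ^ (2 * q + 1))))
    {w : (Fin d → ℕ) → (Fin d → ℕ) → ℝ}
    (hw0 : ∀ α β, 2 * q < ∑ j, α j + ∑ j, β j → w α β = 0)
    (hw : ∀ x y : E d, ∑ s ∈ Finset.range (q + 1), c s * ‖x - y‖ ^ (2 * s) =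
        ∑ α ∈ expBox d (2 * q + 1), ∑ β ∈ expBox d (2 * q + 1),
          w α β * monom α x * monom β y)
    {v : (Fin d → ℕ) → ℝ} (hvk : ∀ α, k < ∑ j, α j → v α = 0)
    (hnull : ∑ α ∈ expBox d (2 * q + 1), ∑ β ∈ expBox d (2 * q + 1), w α β * v α * v β = 0)
    {ι : Type} [Fintype ι] (p : ι → E d) (e : ι → ℝ) (t : ℝ)
    (he : ∀ α : Fin d → ℕ, ∑ j, α j ≤ 2 * q →
        ∑ i, e i * monom α (p i) = if ∑ j, α j = k then t * v α else 0) :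
    0 ≤ c' * ∑ i, ∑ j, e i * e j * ‖p i - p j‖ ^ (2 * q + 1) := by
  obtain ⟨Y, hY⟩ := exists_grid_moments d (2 * q)
  choose a ha' using fun l : ℕ => hY fun α => if ∑ j, α j = l then v α else 0
  have ha : ∀ l, ∀ α : Fin d → ℕ, ∑ j, α j ≤ 2 * q →
      ∑ y, a l y * monom α (Y y) = if ∑ j, α j = l then v α else 0 := fun l α h =>
    ha' l α fun j => (Finset.single_le_sum (f := α) (fun _ _ => Nat.zero_le _)
      (Finset.mem_univ j)).trans h
  let P : ι ⊕ (Fin d → Fin (2 * q + 1)) → E d := Sum.elim p Y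
  -- The grid supplies the parts of `v` of degree `l < k`. The factor `τ^(k-l)` offsets the scaling
  -- `τ^l` of the points, so all moments become `τ^k t v`. The polynomial part of the kernel then
  -- vanishes, and the corrections disappear as `τ → 0`.
  let W : ℝ → ι ⊕ (Fin d → Fin (2 * q + 1)) → ℝ := fun τ =>
    Sum.elim e fun y => t * ∑ l ∈ Finset.range k, τ ^ (k - l) * a l y
  have hmom : ∀ τ, ∀ α : Fin d → ℕ, ∑ j, α j ≤ 2 * q →
      ∑ i, W τ i * monom α (τ • P i) = τ ^ k * (t * v α) := by
    intro τ α hα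
    have h1 : ∑ y, (t * ∑ l ∈ Finset.range k, τ ^ (k - l) * a l y) * monom α (Y y) =
        t * ∑ l ∈ Finset.range k, τ ^ (k - l) * if ∑ j, α j = l then v α else 0 := by
      simp only [← ha _ α hα, Finset.mul_sum, Finset.sum_mul]
      rw [Finset.sum_comm]
      exact Finset.sum_congr rfl fun l _ => Finset.sum_congr rfl fun y _ => by ring
    simp only [monom_smul, mul_left_comm (W τ _), ← Finset.mul_sum]
    simp only [W, P, Fintype.sum_sum_type, Sum.elim_inl, Sum.elim_inr, he α hα, h1]
    rcases lt_trichotomy (∑ j, α j) k with hlt | heq | hgt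
    · simp only [mul_ite, mul_zero, Finset.sum_ite_eq, Finset.mem_range, hlt, hlt.ne, if_true,
        if_false]
      rw [zero_add, mul_left_comm t, ← mul_assoc, ← pow_add, Nat.add_sub_cancel' hlt.le]
    · simp [heq]
    · simp [hvk α hgt]
  have hpoly : ∀ τ, ∑ i, ∑ j, W τ i * W τ j *
      ∑ s ∈ Finset.range (q + 1), c s * ‖τ • P i - τ • P j‖ ^ (2 * s) = 0 := by
    intro τ
    have h1 : ∑ i, ∑ j, W τ i * W τ j *
        ∑ s ∈ Finset.range (q + 1), c s * ‖τ • P i - τ • P j‖ ^ (2 * s) =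
        ∑ α ∈ expBox d (2 * q + 1), ∑ β ∈ expBox d (2 * q + 1), w α β *
          ((∑ i, W τ i * monom α (τ • P i)) * ∑ j, W τ j * monom β (τ • P j)) := by
      simp only [hw, Finset.sum_mul_sum]
      simp only [Finset.mul_sum]
      rw [Finset.sum_congr rfl fun i _ => Finset.sum_comm, Finset.sum_comm]
      refine Finset.sum_congr rfl fun α _ => ?_
      rw [Finset.sum_congr rfl fun i _ => Finset.sum_comm, Finset.sum_comm]
      refine Finset.sum_congr rfl fun β _ => ?_
      exact Finset.sum_congr rfl fun i _ => Finset.sum_congr rfl fun j _ => by ring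
    rw [h1]
    calc _ = ∑ α ∈ expBox d (2 * q + 1), ∑ β ∈ expBox d (2 * q + 1),
          (τ ^ k * t) ^ 2 * (w α β * v α * v β) := by
          refine Finset.sum_congr rfl fun α _ => Finset.sum_congr rfl fun β _ => ?_
          by_cases h2 : 2 * q < ∑ j, α j + ∑ j, β j
          · simp [hw0 α β h2]
          · rw [hmom τ α (by omega), hmom τ β (by omega)]
            ring
      _ = 0 := by simp only [← Finset.mul_sum, hnull, mul_zero]
  have hlim : Tendsto (fun τ : ℝ => ∑ i, ∑ j, W τ i * W τ j * ((f (τ * ‖P i - P j‖) -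
      ∑ s ∈ Finset.range (q + 1), c s * (τ * ‖P i - P j‖) ^ (2 * s)) / τ ^ (2 * q + 1))) (𝓝[>] 0)
      (𝓝 (∑ i, ∑ j, W 0 i * W 0 j * (c' * ‖P i - P j‖ ^ (2 * q + 1)))) := by
    have hWc : ∀ i, Tendsto (fun τ => W τ i) (𝓝[>] 0) (𝓝 (W 0 i)) := by
      intro i
      have : Continuous fun τ => W τ i := by
        rcases i with i | y
        · exact continuous_const
        · simp only [W, Sum.elim_inr]; fun_prop
      exact (this.tendsto 0).mono_left nhdsWithin_le_nhds
    exact tendsto_finsetSum _ fun i _ => tendsto_finsetSum _ fun j _ =>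
      ((hWc i).mul (hWc j)).mul (hf _)
  have h0 : 0 ≤ ∑ i, ∑ j, W 0 i * W 0 j * (c' * ‖P i - P j‖ ^ (2 * q + 1)) := by
    refine ge_of_tendsto hlim ?_
    filter_upwards [self_mem_nhdsWithin] with τ hτ
    have hτ : 0 < τ := hτ
    have hn : ∀ i j, ‖τ • P i - τ • P j‖ = τ * ‖P i - P j‖ := fun i j => by
      rw [← smul_sub, norm_smul, Real.norm_of_nonneg hτ.le]
    have h1 := hpsd _ (fun i => τ • P i) (W τ)
    have h2 := hpoly τ
    simp only [hn] at h1 h2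
    have h3 : ∑ i, ∑ j, W τ i * W τ j * ((f (τ * ‖P i - P j‖) -
        ∑ s ∈ Finset.range (q + 1), c s * (τ * ‖P i - P j‖) ^ (2 * s)) / τ ^ (2 * q + 1)) =
        (∑ i, ∑ j, W τ i * W τ j * f (τ * ‖P i - P j‖)) / τ ^ (2 * q + 1) := by
      rw [← sub_zero (∑ i, ∑ j, W τ i * W τ j * f (τ * ‖P i - P j‖)), ← h2]
      simp only [← Finset.sum_sub_distrib, Finset.sum_div]
      exact Finset.sum_congr rfl fun i _ => Finset.sum_congr rfl fun j _ => by ring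
    rw [h3]
    positivity
  refine h0.trans_eq ?_
  have hW0 : ∀ y, W 0 (Sum.inr y) = 0 := by
    intro y
    simp only [W, Sum.elim_inr]
    rw [Finset.sum_eq_zero, mul_zero]
    intro l hl
    have := Finset.mem_range.1 hl
    rw [zero_pow (by omega), zero_mul]
  simp only [Fintype.sum_sum_type, hW0, zero_mul, mul_zero, Finset.sum_const_zero, add_zero]
  simp only [W, P, Sum.elim_inl, Finset.mul_sum]
  exact Finset.sum_congr rfl fun i _ => Finset.sum_congr rfl fun j _ => by ring

/-- A nonzero null vector, extended by zero, has a nonzero top-degree part. Positive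
semi-definiteness of the kernel and `c' ≠ 0` force that part to vanish. -/
theorem det_wronskian_ne_zero (hd : 1 ≤ d) {f : ℝ → ℝ} {q : ℕ} {c : ℕ → ℝ} {c' : ℝ} (hc' : c' ≠ 0)
    (hpsd : ∀ (ι : Type) [Fintype ι] (p : ι → E d) (e : ι → ℝ),
      0 ≤ ∑ i, ∑ j, e i * e j * f ‖p i - p j‖)
    (hf : ∀ ρ : ℝ, Tendsto (fun τ : ℝ => (f (τ * ρ) -
      ∑ s ∈ Finset.range (q + 1), c s * (τ * ρ) ^ (2 * s)) / τ ^ (2 * q + 1))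
      (𝓝[>] 0) (𝓝 (c' * ρ ^ (2 * q + 1))))
    {w : (Fin d → ℕ) → (Fin d → ℕ) → ℝ}
    (hw0 : ∀ α β, 2 * q < ∑ j, α j + ∑ j, β j → w α β = 0)
    (hw : ∀ x y : E d, ∑ s ∈ Finset.range (q + 1), c s * ‖x - y‖ ^ (2 * s) =
        ∑ α ∈ expBox d (2 * q + 1), ∑ β ∈ expBox d (2 * q + 1),
          w α β * monom α x * monom β y) :
    (Matrix.of fun α β : MultiIndex d q => w α.exp β.exp).det ≠ 0 := by
  intro hdet
  obtain ⟨v, hv, hWv⟩ := Matrix.exists_mulVec_eq_zero_iff.2 hdet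
  let v' : (Fin d → ℕ) → ℝ := Function.extend MultiIndex.exp v 0
  have hv' : ∀ α : MultiIndex d q, v' α.exp = v α := fun α =>
    MultiIndex.exp_injective.extend_apply _ _ _
  have hv0 : ∀ α : Fin d → ℕ, q < ∑ j, α j → v' α = 0 := fun α hα =>
    Function.extend_apply' _ _ _ (by rintro ⟨β, rfl⟩; exact absurd β.sum_exp_le (not_le.2 hα))
  obtain ⟨α₁, hα₁⟩ := Function.ne_iff.1 hv
  obtain ⟨α₀, hα₀, hmax⟩ := Finset.exists_max_image (Finset.univ.filter fun α => v α ≠ 0)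
    (fun α => ∑ j, α.exp j) ⟨α₁, by simpa using hα₁⟩
  have hα₀ : v α₀ ≠ 0 := by simpa using hα₀
  set k := ∑ j, α₀.exp j with hk
  have hvk : ∀ α, k < ∑ j, α j → v' α = 0 := by
    intro α hα
    by_contra hne
    have hle : ∑ j, α j ≤ q := not_lt.1 fun h => hne (hv0 α h)
    obtain ⟨β, rfl⟩ := MultiIndex.exists_exp_eq hle
    have := hmax β (by rw [hv'] at hne; simpa using hne)
    exact absurd this (not_le.2 hα)
  have hnull : ∑ α ∈ expBox d (2 * q + 1), ∑ β ∈ expBox d (2 * q + 1), w α β * v' α * v' β = 0 := by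
    have hsum : ∀ F : (Fin d → ℕ) → ℝ, (∀ α, q < ∑ j, α j → F α = 0) →
        ∑ α ∈ expBox d (2 * q + 1), F α = ∑ α : MultiIndex d q, F α.exp := by
      intro F hF
      rw [sum_expBox_eq (k := q) (by omega), add_eq_left]
      exact Finset.sum_eq_zero fun α hα => hF α (Finset.mem_filter.1 hα).2
    rw [hsum _ fun α hα => Finset.sum_eq_zero fun β _ => by rw [hv0 α hα]; ring]
    refine Finset.sum_eq_zero fun α _ => ?_
    rw [hsum _ fun β hβ => by rw [hv0 β hβ, mul_zero]]
    have h1 := congrFun hWv α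
    simp only [Matrix.mulVec, dotProduct, Matrix.of_apply, Pi.zero_apply] at h1
    simp only [hv', mul_right_comm _ (v α), ← Finset.sum_mul, h1, zero_mul]
  have := moments_eq_zero_of_nonneg hd (k := k) α₀.sum_exp_le hc' (v := v')
    (fun ι _ p e t he => odd_form_nonneg_of_null hpsd hf hw0 hw hvk hnull p e t he) hk.symm
  rw [hv'] at this
  exact hα₀ this

end KernelExpansion

/-! ### Asymptotics of kernel determinants as `ε → 0`. -/

section FlatLimit

open Matrix

variable {d : ℕ}

/-- The kernel coefficients on monomials of degree at most `q`. -/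
def lowBlock (q : ℕ) (w : (Fin d → ℕ) → (Fin d → ℕ) → ℝ) :
    Matrix (MultiIndex d q) (MultiIndex d q) ℝ :=
  Matrix.of fun α β => w α.exp β.exp

/-- The block of kernel coefficients at scale `ε`. -/
def scaledBlock (q : ℕ) (w : (Fin d → ℕ) → (Fin d → ℕ) → ℝ) (ε : ℝ) :
    Matrix (MultiIndex d q) (MultiIndex d q) ℝ :=
  diagonal (fun α => ε ^ ∑ j, α.exp j) * lowBlock q w * diagonal (fun α => ε ^ ∑ j, α.exp j)

theorem det_scaledBlock_ne_zero {q : ℕ} {w : (Fin d → ℕ) → (Fin d → ℕ) → ℝ}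
    (hW : (lowBlock q w).det ≠ 0) {ε : ℝ} (hε : 0 < ε) : (scaledBlock q w ε).det ≠ 0 := by
  rw [scaledBlock, det_mul, det_mul, det_diagonal]
  have : ∏ α : MultiIndex d q, ε ^ ∑ j, α.exp j ≠ 0 :=
    Finset.prod_ne_zero_iff.2 fun α _ => pow_ne_zero _ hε.ne'
  exact mul_ne_zero (mul_ne_zero this hW) this

/-- Both degrees are at most `q`, so every exponent is at least `1` and the rescaled inverse tends
to `0`. -/
theorem inv_scaledBlock {q : ℕ} {w : (Fin d → ℕ) → (Fin d → ℕ) → ℝ}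
    (hW : (lowBlock q w).det ≠ 0) {ε : ℝ} (hε : 0 < ε) :
    ε ^ (2 * q + 1) • (scaledBlock q w ε)⁻¹ = Matrix.of fun α β : MultiIndex d q =>
      ε ^ (2 * q + 1 - ∑ j, α.exp j - ∑ j, β.exp j) * (lowBlock q w)⁻¹ α β := by
  have ht : ε ^ (2 * q + 1) ≠ 0 := pow_ne_zero _ hε.ne'
  set Z : Matrix (MultiIndex d q) (MultiIndex d q) ℝ := Matrix.of fun α β : MultiIndex d q =>
      ε ^ (2 * q + 1 - ∑ j, α.exp j - ∑ j, β.exp j) * (lowBlock q w)⁻¹ α β with hZ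
  have h1 : scaledBlock q w ε * Z = ε ^ (2 * q + 1) • 1 := by
    ext α γ
    have h2 := congrFun (congrFun (mul_nonsing_inv (lowBlock q w) (isUnit_iff_ne_zero.2 hW)) α) γ
    rw [mul_apply] at h2
    calc (scaledBlock q w ε * Z) α γ
        = ∑ β, ε ^ (∑ j, α.exp j) * ε ^ (2 * q + 1 - ∑ j, γ.exp j) *
            (lowBlock q w α β * (lowBlock q w)⁻¹ β γ) := by
          rw [mul_apply]
          refine Finset.sum_congr rfl fun β _ => ?_
          have hb := β.sum_exp_le
          have hc := γ.sum_exp_le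
          rw [show 2 * q + 1 - ∑ j, γ.exp j =
            ∑ j, β.exp j + (2 * q + 1 - ∑ j, β.exp j - ∑ j, γ.exp j) by omega, pow_add]
          simp only [scaledBlock, mul_diagonal, diagonal_mul, hZ, Matrix.of_apply]
          ring
      _ = (ε ^ (2 * q + 1) • (1 : Matrix _ _ ℝ)) α γ := by
          rw [← Finset.mul_sum, h2, Matrix.smul_apply, one_apply]
          split_ifs with h
          · subst h
            have := α.sum_exp_le
            rw [← pow_add, Nat.add_sub_cancel' (by omega)]
            simp
          · simp
  have h3 : (scaledBlock q w ε)⁻¹ = (ε ^ (2 * q + 1))⁻¹ • Z := by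
    refine inv_eq_right_inv ?_
    rw [Matrix.mul_smul, h1, smul_smul, inv_mul_cancel₀ ht, one_smul]
  rw [h3, smul_smul, mul_inv_cancel₀ ht, one_smul]

/-- The common behaviour of all kernel determinants in the flat limit. -/
theorem exists_tendsto_det_kernel {f : ℝ → ℝ} {q : ℕ} {c : ℕ → ℝ} {c' : ℝ}
    (hf : ∀ ρ : ℝ, Tendsto (fun τ : ℝ => (f (τ * ρ) -
      ∑ s ∈ Finset.range (q + 1), c s * (τ * ρ) ^ (2 * s)) / τ ^ (2 * q + 1))
      (𝓝[>] 0) (𝓝 (c' * ρ ^ (2 * q + 1))))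
    {w : (Fin d → ℕ) → (Fin d → ℕ) → ℝ}
    (hw0 : ∀ α β, 2 * q < ∑ j, α j + ∑ j, β j → w α β = 0)
    (hw : ∀ x y : E d, ∑ s ∈ Finset.range (q + 1), c s * ‖x - y‖ ^ (2 * s) =
        ∑ α ∈ expBox d (2 * q + 1), ∑ β ∈ expBox d (2 * q + 1),
          w α β * monom α x * monom β y)
    (hW : (lowBlock q w).det ≠ 0) {ι : Type*} [Fintype ι] [DecidableEq ι] (x : ι → E d) :
    ∃ S : ℝ → ℝ,
      Tendsto S (𝓝[>] 0) (𝓝 (fromBlocks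
        (c' • Matrix.of fun i j => ‖x i - x j‖ ^ (2 * q + 1))
        (Matrix.of fun i (α : MultiIndex d q) => monom α.exp (x i))
        (Matrix.of fun i (α : MultiIndex d q) => monom α.exp (x i))ᵀ 0).det) ∧
      ∀ ε : ℝ, 0 < ε →
        (ε ^ (2 * q + 1)) ^ Fintype.card (MultiIndex d q) *
            (Matrix.of fun i j => f (ε * ‖x i - x j‖)).det =
          (-1) ^ Fintype.card (MultiIndex d q) * (scaledBlock q w ε).det *
            (ε ^ (2 * q + 1)) ^ Fintype.card ι * S ε := by
  let W := lowBlock q w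
  let high := (expBox d (2 * q + 1)).filter fun α => q < ∑ j, α j
  let V : Matrix ι (MultiIndex d q) ℝ := Matrix.of fun i α => monom α.exp (x i)
  -- `B` and `B'` carry the mixed low-high terms, with the common factor `ε^(q+1)` taken out.
  let B : ℝ → Matrix (MultiIndex d q) ι ℝ := fun ε => Matrix.of fun α i =>
    ∑ β ∈ high, w α.exp β * (ε ^ (∑ j, β j - (q + 1)) * monom β (x i))
  let B' : ℝ → Matrix ι (MultiIndex d q) ℝ := fun ε => Matrix.of fun i β =>
    ∑ α ∈ high, w α β.exp * (ε ^ (∑ j, α j - (q + 1)) * monom α (x i))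
  let R : ℝ → Matrix ι ι ℝ := fun ε => Matrix.of fun i j => f (ε * ‖x i - x j‖) -
    ∑ s ∈ Finset.range (q + 1), c s * (ε * ‖x i - x j‖) ^ (2 * s)
  let U : ℝ → Matrix ι (MultiIndex d q) ℝ := fun ε => V + Matrix.of fun i β =>
    (B' ε * W⁻¹) i β * ε ^ (q + 1 - ∑ j, β.exp j)
  let U' : ℝ → Matrix (MultiIndex d q) ι ℝ := fun ε => Vᵀ + Matrix.of fun α i =>
    ε ^ (q + 1 - ∑ j, α.exp j) * (W⁻¹ * B ε) α i
  let Z : ℝ → Matrix (MultiIndex d q) (MultiIndex d q) ℝ := fun ε => Matrix.of fun α β =>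
      ε ^ (2 * q + 1 - ∑ j, α.exp j - ∑ j, β.exp j) * W⁻¹ α β
  -- Completing the square adds `ε^(2q+2) B' W⁻¹ B`. After division by `ε^(2q+1)` this is subtracted
  -- here and is still `O(ε)`.
  let A : ℝ → Matrix ι ι ℝ := fun ε =>
    (ε ^ (2 * q + 1))⁻¹ • R ε - ε • (B' ε * W⁻¹ * B ε)
  have hBc : Continuous B := continuous_matrix fun α i => by
    simp only [B, Matrix.of_apply]; fun_prop
  have hB'c : Continuous B' := continuous_matrix fun α i => by
    simp only [B', Matrix.of_apply]; fun_prop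
  refine ⟨fun ε => (fromBlocks (A ε) (U ε) (U' ε) (-Z ε)).det, ?_, ?_⟩
  · have hA : Tendsto A (𝓝[>] 0)
        (𝓝 (c' • Matrix.of fun i j => ‖x i - x j‖ ^ (2 * q + 1))) := by
      have h1 : Tendsto (fun ε => (ε ^ (2 * q + 1))⁻¹ • R ε) (𝓝[>] 0)
          (𝓝 (c' • Matrix.of fun i j => ‖x i - x j‖ ^ (2 * q + 1))) := by
        refine tendsto_pi_nhds.2 fun i => tendsto_pi_nhds.2 fun j => ?_
        refine (hf ‖x i - x j‖).congr fun ε => ?_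
        simp only [R, Matrix.smul_apply, Matrix.of_apply, smul_eq_mul]
        rw [div_eq_inv_mul]
      have h2 : Tendsto (fun ε => ε • (B' ε * W⁻¹ * B ε)) (𝓝[>] 0) (𝓝 0) := by
        have hc : Continuous fun ε : ℝ => ε • (B' ε * W⁻¹ * B ε) :=
          continuous_id.smul ((hB'c.matrix_mul continuous_const).matrix_mul hBc)
        have := hc.tendsto 0
        rw [zero_smul] at this
        exact this.mono_left nhdsWithin_le_nhds
      simpa using h1.sub h2
    have hU : Tendsto U (𝓝[>] 0) (𝓝 V) := by
      have hc : Continuous U := by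
        refine continuous_const.add (continuous_matrix fun i β => ?_)
        simp only [Matrix.of_apply]
        exact ((hB'c.matrix_mul continuous_const).matrix_elem i β).mul (by fun_prop)
      have h0 : U 0 = V := by
        ext i β
        have := β.sum_exp_le
        simp only [U, Matrix.add_apply, Matrix.of_apply]
        rw [zero_pow (by omega), mul_zero, add_zero]
      have := hc.tendsto 0
      rw [h0] at this
      exact this.mono_left nhdsWithin_le_nhds
    have hU' : Tendsto U' (𝓝[>] 0) (𝓝 Vᵀ) := by
      have hc : Continuous U' := by
        refine continuous_const.add (continuous_matrix fun α i => ?_)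
        simp only [Matrix.of_apply]
        exact Continuous.mul (by fun_prop) ((continuous_const.matrix_mul hBc).matrix_elem α i)
      have h0 : U' 0 = Vᵀ := by
        ext α i
        have := α.sum_exp_le
        simp only [U', Matrix.add_apply, Matrix.of_apply]
        rw [zero_pow (by omega), zero_mul, add_zero]
      have := hc.tendsto 0
      rw [h0] at this
      exact this.mono_left nhdsWithin_le_nhds
    have hZ : Tendsto (fun ε => -Z ε) (𝓝[>] 0) (𝓝 0) := by
      have hc : Continuous fun ε => -Z ε := by
        refine Continuous.neg (continuous_matrix fun α β => ?_)
        simp only [Z, Matrix.of_apply]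
        fun_prop
      have h0 : -Z 0 = 0 := by
        ext α β
        have := α.sum_exp_le
        have := β.sum_exp_le
        simp only [Z, Matrix.neg_apply, Matrix.of_apply]
        rw [zero_pow (by omega), zero_mul, neg_zero, Matrix.zero_apply]
      have := hc.tendsto 0
      rw [h0] at this
      exact this.mono_left nhdsWithin_le_nhds
    refine ((continuous_id.matrix_det).tendsto _).comp ?_
    refine tendsto_pi_nhds.2 fun i => tendsto_pi_nhds.2 fun j => ?_
    rcases i with i | i <;> rcases j with j | j
    · exact tendsto_pi_nhds.1 (tendsto_pi_nhds.1 hA i) j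
    · exact tendsto_pi_nhds.1 (tendsto_pi_nhds.1 hU i) j
    · exact tendsto_pi_nhds.1 (tendsto_pi_nhds.1 hU' i) j
    · exact tendsto_pi_nhds.1 (tendsto_pi_nhds.1 hZ i) j
  · intro ε hε
    have ht : ε ^ (2 * q + 1) ≠ 0 := pow_ne_zero _ hε.ne'
    have hWu : IsUnit W.det := isUnit_iff_ne_zero.2 hW
    let Δ : Matrix (MultiIndex d q) (MultiIndex d q) ℝ := diagonal fun α => ε ^ ∑ j, α.exp j
    have hUΔ : U ε * Δ = V * Δ + ε ^ (q + 1) • (B' ε * W⁻¹) := by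
      ext i β
      have hβ : ε ^ (q + 1) = ε ^ (q + 1 - ∑ j, β.exp j) * ε ^ ∑ j, β.exp j := by
        rw [← pow_add, Nat.sub_add_cancel (by have := β.sum_exp_le; omega)]
      simp only [Δ, U, mul_diagonal, Matrix.add_apply, Matrix.of_apply, Matrix.smul_apply,
        smul_eq_mul, hβ]
      ring
    have hΔU : Δ * U' ε = Δ * Vᵀ + ε ^ (q + 1) • (W⁻¹ * B ε) := by
      ext α i
      have hα : ε ^ (q + 1) = ε ^ (q + 1 - ∑ j, α.exp j) * ε ^ ∑ j, α.exp j := by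
        rw [← pow_add, Nat.sub_add_cancel (by have := α.sum_exp_le; omega)]
      simp only [Δ, U', diagonal_mul, Matrix.add_apply, Matrix.of_apply, Matrix.smul_apply,
        smul_eq_mul, hα]
      ring
    have hpoly : (Matrix.of fun i j => f (ε * ‖x i - x j‖)) = R ε + (V * Δ * W * (Δ * Vᵀ) +
        ε ^ (q + 1) • (V * Δ * B ε) + ε ^ (q + 1) • (B' ε * (Δ * Vᵀ))) := by
      ext i j
      have h1 := hw (ε • x i) (ε • x j)
      rw [← smul_sub, norm_smul, Real.norm_of_nonneg hε.le] at h1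
      have hlow : ∀ (α : MultiIndex d q) i, (V * Δ) i α = monom α.exp (ε • x i) := fun α i => by
        simp only [V, Δ, mul_diagonal, Matrix.of_apply, monom_smul]; ring
      have hlow' : ∀ (α : MultiIndex d q) i, (Δ * Vᵀ) α i = monom α.exp (ε • x i) := fun α i => by
        simp only [V, Δ, diagonal_mul, transpose_apply, Matrix.of_apply, monom_smul]
      have hhigh : ∀ α ∈ high, ∀ i, monom α (ε • x i) =
          ε ^ (q + 1) * (ε ^ (∑ j, α j - (q + 1)) * monom α (x i)) := fun α hα i => by
        have := (Finset.mem_filter.1 hα).2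
        rw [monom_smul, ← mul_assoc, ← pow_add, Nat.add_sub_cancel' (by omega)]
      simp only [Matrix.add_apply, Matrix.smul_apply, smul_eq_mul, R, Matrix.of_apply]
      rw [h1, sum_expBox_eq (k := q) (by omega)]
      simp only [sum_expBox_eq (d := d) (k := q) (N := 2 * q + 1) (by omega)]
      have hhh : ∑ α ∈ high, ∑ β ∈ high, w α β * monom α (ε • x i) * monom β (ε • x j) = 0 :=
        Finset.sum_eq_zero fun α hα => Finset.sum_eq_zero fun β hβ => by
          have h2 := (Finset.mem_filter.1 hα).2
          have h3 := (Finset.mem_filter.1 hβ).2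
          rw [hw0 α β (by omega)]; ring
      have hll : ∑ α : MultiIndex d q, ∑ β : MultiIndex d q,
          w α.exp β.exp * monom α.exp (ε • x i) * monom β.exp (ε • x j) =
          (V * Δ * W * (Δ * Vᵀ)) i j := by
        rw [mul_apply, Finset.sum_comm]
        refine Finset.sum_congr rfl fun β _ => ?_
        rw [mul_apply, hlow', Finset.sum_mul]
        refine Finset.sum_congr rfl fun α _ => ?_
        rw [hlow]
        simp only [W, lowBlock, Matrix.of_apply]; ring
      have hlh : ∑ α : MultiIndex d q, ∑ β ∈ high,
          w α.exp β * monom α.exp (ε • x i) * monom β (ε • x j) =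
          ε ^ (q + 1) * (V * Δ * B ε) i j := by
        rw [mul_apply, Finset.mul_sum]
        refine Finset.sum_congr rfl fun α _ => ?_
        rw [hlow]
        simp only [B, Matrix.of_apply, Finset.mul_sum]
        refine Finset.sum_congr rfl fun β hβ => ?_
        rw [hhigh β hβ]; ring
      have hhl : ∑ α ∈ high, ∑ β : MultiIndex d q,
          w α β.exp * monom α (ε • x i) * monom β.exp (ε • x j) =
          ε ^ (q + 1) * (B' ε * (Δ * Vᵀ)) i j := by
        rw [mul_apply, Finset.mul_sum, Finset.sum_comm]
        refine Finset.sum_congr rfl fun β _ => ?_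
        rw [hlow']
        simp only [B', Matrix.of_apply, Finset.mul_sum, Finset.sum_mul]
        refine Finset.sum_congr rfl fun α hα => ?_
        rw [hhigh α hα]; ring
      simp only [Finset.sum_add_distrib]
      rw [hll, hlh, hhl, hhh]
      ring
    have hK : (Matrix.of fun i j => f (ε * ‖x i - x j‖)) =
        ε ^ (2 * q + 1) • A ε + U ε * scaledBlock q w ε * U' ε := by
      have h1 : U ε * scaledBlock q w ε * U' ε = (U ε * Δ) * W * (Δ * U' ε) := by
        simp only [scaledBlock, Δ, W, Matrix.mul_assoc]
      have h2 : ε ^ (2 * q + 1) • A ε =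
          R ε - (ε ^ (q + 1) * ε ^ (q + 1)) • (B' ε * W⁻¹ * B ε) := by
        simp only [A, smul_sub, smul_smul, mul_inv_cancel₀ ht, one_smul]
        congr 2
        ring
      have h3 : (V * Δ) * W * (W⁻¹ * B ε) = V * Δ * B ε := by
        rw [Matrix.mul_assoc, mul_nonsing_inv_cancel_left _ _ hWu]
      have h4 : (B' ε * W⁻¹) * W = B' ε := nonsing_inv_mul_cancel_right _ _ hWu
      rw [h1, h2, hUΔ, hΔU, hpoly]
      simp only [Matrix.add_mul, Matrix.mul_add, Matrix.smul_mul, Matrix.mul_smul, h3, h4,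
        smul_smul, smul_add]
      rw [Matrix.mul_assoc (B' ε) W⁻¹ (B ε)]
      abel
    rw [hK, det_add_mul_mul _ _ _ _ (det_scaledBlock_ne_zero hW hε)]
    have h5 := pow_mul_det_fromBlocks_smul (ε ^ (2 * q + 1)) (A ε) (U ε) (U' ε)
      (-(scaledBlock q w ε)⁻¹)
    rw [smul_neg, inv_scaledBlock hW hε] at h5
    change _ = _ * (fromBlocks (A ε) (U ε) (U' ε) (-Z ε)).det at h5
    linear_combination ((-1) ^ Fintype.card (MultiIndex d q) * (scaledBlock q w ε).det) * h5

end FlatLimit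

/-! ### Existence and convergence of the laws. -/

section Laws

open Matrix

variable {d n : ℕ}

theorem exists_pmf_of_fixedSize {m : ℕ} {g : Finset (Fin n) → ℝ}
    (h0 : ∀ X, X.card = m → 0 ≤ g X)
    (hZ : 0 < ∑ Y ∈ Finset.powersetCard m Finset.univ, g Y) :
    ∃ P : PMF (Finset (Fin n)), ∀ X, (P X).toReal =
      if X.card = m then g X / ∑ Y ∈ Finset.powersetCard m Finset.univ, g Y else 0 := by
  set Z := ∑ Y ∈ Finset.powersetCard m Finset.univ, g Y with hZdef
  let F : Finset (Fin n) → ℝ := fun X => if X.card = m then g X / Z else 0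
  have hF : ∀ X, 0 ≤ F X := by
    intro X
    simp only [F]
    split_ifs with h
    · exact div_nonneg (h0 X h) hZ.le
    · exact le_rfl
  have hsum : ∑ X, F X = 1 := by
    simp only [F]
    rw [← Finset.sum_filter, ← Finset.sum_div]
    have : Finset.univ.filter (fun X : Finset (Fin n) => X.card = m) =
        Finset.powersetCard m Finset.univ := by
      ext X; simp [Finset.mem_powersetCard]
    rw [this, ← hZdef, div_self hZ.ne']
  refine ⟨PMF.ofFintype (fun X => ENNReal.ofReal (F X)) ?_, fun X => ?_⟩
  · rw [← ENNReal.ofReal_sum_of_nonneg fun X _ => hF X, hsum, ENNReal.ofReal_one]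
  · rw [PMF.ofFintype_apply, ENNReal.toReal_ofReal (hF X)]

/-- Row rank equals column rank: a maximal independent family of rows has as many members as `V` has
columns, and it can be padded to size `m`. This provides a set with positive saddle minor. -/
theorem exists_finset_rows_injective {ι : Type*} [Fintype ι] {V : Matrix (Fin n) ι ℝ}
    (hV : LinearIndependent ℝ V.col) {m : ℕ} (hm : Fintype.card ι ≤ m) (hmn : m ≤ n) :
    ∃ X : Finset (Fin n), X.card = m ∧
      ∀ u, (V.submatrix (fun i : X => (i : Fin n)) id) *ᵥ u = 0 → u = 0 := by
  classical
  have hrank : V.rank = Fintype.card ι := by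
    rw [← rank_transpose]; exact LinearIndependent.rank_matrix (M := Vᵀ) hV
  have hspan : Submodule.span ℝ (Set.range V.row) = ⊤ := by
    refine Submodule.eq_top_of_finrank_eq ?_
    rw [← rank_eq_finrank_span_row, hrank, Module.finrank_fintype_fun_eq_card]
  obtain ⟨κ, a, ha, hsp, hli⟩ := exists_linearIndependent' ℝ V.row
  rw [hspan] at hsp
  have : Finite κ := Finite.of_injective a ha
  have := Fintype.ofFinite κ
  have hcard : Fintype.card κ = Fintype.card ι := by
    rw [← finrank_span_eq_card hli, hsp, finrank_top, Module.finrank_fintype_fun_eq_card]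
  have hc0 : (Finset.univ.image a).card = Fintype.card ι := by
    rw [Finset.card_image_of_injective _ ha, Finset.card_univ, hcard]
  obtain ⟨X, hX, -, hXm⟩ := Finset.exists_subsuperset_card_eq
    (Finset.subset_univ (Finset.univ.image a)) (hc0 ▸ hm) (by simpa using hmn)
  refine ⟨X, hXm, fun u hu => ?_⟩
  have h1 : ∀ y ∈ Submodule.span ℝ (Set.range (V.row ∘ a)), y ⬝ᵥ u = 0 := by
    intro y hy
    induction hy using Submodule.span_induction with
    | mem y hy =>
      obtain ⟨k, rfl⟩ := hy
      have hk : a k ∈ X := hX (Finset.mem_image_of_mem a (Finset.mem_univ k))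
      exact congrFun hu ⟨a k, hk⟩
    | zero => simp
    | add y z _ _ hy hz => rw [add_dotProduct, hy, hz, add_zero]
    | smul t y _ hy => rw [smul_dotProduct, hy, smul_zero]
  exact dotProduct_self_eq_zero.1 (h1 u (by rw [hsp]; trivial))

theorem dotProduct_smul_norm_pow {ι : Type*} [Fintype ι] (s : ℝ) (u : ι → ℝ) (x : ι → E d)
    (N : ℕ) (A : Matrix ι ι ℝ) (hA : ∀ i j, A i j = s * ‖x i - x j‖ ^ N) :
    u ⬝ᵥ A *ᵥ u = s * ∑ i, ∑ j, u i * u j * ‖x i - x j‖ ^ N := by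
  simp only [dotProduct, mulVec, hA, Finset.mul_sum]
  exact Finset.sum_congr rfl fun i _ => Finset.sum_congr rfl fun j _ => by ring

theorem dotProduct_norm_pow_pos (hd : 1 ≤ d) {ι : Type*} [Fintype ι] {q : ℕ} {x : ι → E d}
    (hx : Function.Injective x) {A : Matrix ι ι ℝ}
    (hA : ∀ i j, A i j = (-1) ^ (q + 1) * ‖x i - x j‖ ^ (2 * q + 1))
    {V : Matrix ι (MultiIndex d q) ℝ} (hV : ∀ i α, V i α = monom α.exp (x i)) {u : ι → ℝ}
    (hu : Vᵀ *ᵥ u = 0) (hu0 : u ≠ 0) : 0 < u ⬝ᵥ A *ᵥ u := by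
  rw [dotProduct_smul_norm_pow _ u x _ A hA]
  refine norm_pow_condPosDef hd hx hu0 fun α hα => ?_
  obtain ⟨β, rfl⟩ := MultiIndex.exists_exp_eq hα
  have := congrFun hu β
  simp only [mulVec, dotProduct, transpose_apply, hV, Pi.zero_apply] at this
  rw [← this]
  exact Finset.sum_congr rfl fun i _ => mul_comm _ _

theorem isNonnegativePair_distMatrix (hd : 1 ≤ d) {q : ℕ} {x : Fin n → E d}
    (hx : Function.Injective x) (hV : LinearIndependent ℝ (vandermondeLE x q).col) :
    IsNonnegativePair ((-1 : ℝ) ^ (q + 1) • distMatrix x (2 * q + 1)) (vandermondeLE x q) where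
  symm := by
    ext i j
    simp [distMatrix, norm_sub_rev]
  condPosSemidef := by
    intro u hu
    by_cases h0 : u = 0
    · simp [h0]
    · exact (dotProduct_norm_pow_pos hd hx (fun i j => by simp [distMatrix])
        (fun i α => vandermondeLE_apply x i α) hu h0).le
  fullColRank := hV

theorem saddleMinor_pos (hd : 1 ≤ d) {q : ℕ} {x : Fin n → E d} (hx : Function.Injective x)
    {X : Finset (Fin n)}
    (hX : ∀ u, ((vandermondeLE x q).submatrix (fun i : X => (i : Fin n)) id) *ᵥ u = 0 → u = 0) :
    0 < saddleMinor ((-1 : ℝ) ^ (q + 1) • distMatrix x (2 * q + 1)) (vandermondeLE x q) X :=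
  det_saddle_pos _ _ (fun _ hu hu0 => dotProduct_norm_pow_pos hd
    (x := fun i : X => x i) (hx.comp Subtype.val_injective)
    (fun i j => by simp [distMatrix]) (fun i α => vandermondeLE_apply x i α) hu hu0) hX

theorem saddleMinor_nonneg (hd : 1 ≤ d) {q : ℕ} {x : Fin n → E d} (hx : Function.Injective x)
    (X : Finset (Fin n)) :
    0 ≤ saddleMinor ((-1 : ℝ) ^ (q + 1) • distMatrix x (2 * q + 1)) (vandermondeLE x q) X := by
  by_cases hX : ∀ u, ((vandermondeLE x q).submatrix (fun i : X => (i : Fin n)) id) *ᵥ u = 0 → u = 0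
  · exact (saddleMinor_pos hd hx hX).le
  · rw [saddleMinor, det_saddle_eq_zero _ _ hX, mul_zero]

theorem sum_saddleMinor_pos (hd : 1 ≤ d) {q m : ℕ} {x : Fin n → E d} (hx : Function.Injective x)
    (hV : LinearIndependent ℝ (vandermondeLE x q).col) (hm : polyDim q d ≤ m) (hmn : m ≤ n) :
    0 < ∑ Y ∈ Finset.powersetCard m Finset.univ,
      saddleMinor ((-1 : ℝ) ^ (q + 1) • distMatrix x (2 * q + 1)) (vandermondeLE x q) Y := by
  obtain ⟨X, hXm, hX⟩ := exists_finset_rows_injective hV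
    ((card_multiIndex_le d q).trans hm) hmn
  exact Finset.sum_pos' (fun Y _ => saddleMinor_nonneg hd hx Y)
    ⟨X, by simp [Finset.mem_powersetCard, hXm], saddleMinor_pos hd hx hX⟩

theorem kernelMatrix_apply {κ : E d → E d → ℝ} {f : ℝ → ℝ} (hκ : IsStationaryKernel κ f)
    {ε : ℝ} (hε : 0 < ε) (x : Fin n → E d) (i j : Fin n) :
    kernelMatrix κ ε x i j = f (ε * ‖x i - x j‖) := by
  simp only [kernelMatrix, scaledKernel, Matrix.of_apply, hκ.stationary]
  rw [← smul_sub, norm_smul, Real.norm_of_nonneg hε.le]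

theorem kernelMatrix_posSemidef {κ : E d → E d → ℝ} {f : ℝ → ℝ} (hκ : IsStationaryKernel κ f)
    (ε : ℝ) (x : Fin n → E d) : (kernelMatrix κ ε x).PosSemidef :=
  hκ.posSemidef n fun i => ε • x i

/-- Up to a common factor, the principal minors of order `m` of the kernel matrix converge to the
saddle-point minors. -/
theorem exists_tendsto_principalMinor (hd : 1 ≤ d) {q : ℕ} (m : ℕ) (x : Fin n → E d)
    {κ : E d → E d → ℝ} {f : ℝ → ℝ} (hκ : IsStationaryKernel κ f)
    (hf : HasSmoothnessOrder f (q + 1)) :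
    ∃ (a : ℝ → ℝ) (γ : ℝ) (S : Finset (Fin n) → ℝ → ℝ), (∀ ε, 0 < ε → a ε ≠ 0) ∧ γ ≠ 0 ∧
      (∀ X, X.card = m → ∀ ε, 0 < ε → principalMinor (kernelMatrix κ ε x) X = a ε * S X ε) ∧
      ∀ X, X.card = m → Tendsto (S X) (𝓝[>] 0) (𝓝 (γ *
        saddleMinor ((-1 : ℝ) ^ (q + 1) • distMatrix x (2 * q + 1)) (vandermondeLE x q) X)) := by
  set c' := taylorCoeff f (2 * q + 1) with hc'def
  have hc' : c' ≠ 0 := by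
    have := hf.1.2
    rwa [show 2 * (q + 1) - 1 = 2 * q + 1 by omega] at this
  obtain ⟨w, hw0, hw⟩ := exists_monom_expansion d q fun s => taylorCoeff f (2 * s)
  have hrem := tendsto_profile_remainder hκ.analytic hf
  have hW : (lowBlock q w).det ≠ 0 := det_wronskian_ne_zero hd hc'
    (fun ι _ p e => sum_sum_mul_nonneg_of_stationary hκ p e) hrem hw0 hw
  choose S hS hdet using fun X : Finset (Fin n) =>
    exists_tendsto_det_kernel hrem hw0 hw hW (fun i : X => x i)
  let p := Fintype.card (MultiIndex d q)
  -- `b` converts `(-1)^(q+1) D` into `c' D`. On sets of size `m` this rescaling multiplies the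
  -- determinant by `b^m / b^p`, independently of the set.
  let b : ℝ := c' * (-1) ^ (q + 1)
  have hb : b ≠ 0 := mul_ne_zero hc' (pow_ne_zero _ (by norm_num))
  have h1 : ((-1 : ℝ) ^ p) * (-1) ^ p = 1 := by rw [← mul_pow]; simp
  refine ⟨fun ε => (-1) ^ p * (scaledBlock q w ε).det * (ε ^ (2 * q + 1)) ^ m /
      (ε ^ (2 * q + 1)) ^ p, (-1) ^ p * b ^ m / b ^ p, S, fun ε hε => ?_, ?_,
      fun X hX ε hε => ?_, fun X hX => ?_⟩
  · have ht : ε ^ (2 * q + 1) ≠ 0 := pow_ne_zero _ hε.ne'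
    exact div_ne_zero (mul_ne_zero (mul_ne_zero (pow_ne_zero _ (by norm_num))
      (det_scaledBlock_ne_zero hW hε)) (pow_ne_zero _ ht)) (pow_ne_zero _ ht)
  · exact div_ne_zero (mul_ne_zero (pow_ne_zero _ (by norm_num)) (pow_ne_zero _ hb))
      (pow_ne_zero _ hb)
  · have ht : (ε ^ (2 * q + 1)) ^ p ≠ 0 := pow_ne_zero _ (pow_ne_zero _ hε.ne')
    have h2 := hdet X ε hε
    rw [Fintype.card_coe, hX] at h2
    have h3 : principalMinor (kernelMatrix κ ε x) X =
        (Matrix.of fun i j : X => f (ε * ‖x i - x j‖)).det := by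
      rw [principalMinor]
      congr 1
      ext i j
      simp [kernelMatrix_apply hκ hε]
    rw [h3, div_mul_eq_mul_div, eq_div_iff ht, mul_comm, h2]
  · have h2 := pow_mul_det_fromBlocks_smul b
      (((-1 : ℝ) ^ (q + 1) • distMatrix x (2 * q + 1)).submatrix (fun i : X => (i : Fin n))
        (fun i : X => (i : Fin n)))
      ((vandermondeLE x q).submatrix (fun i : X => (i : Fin n)) id)
      ((vandermondeLE x q).submatrix (fun i : X => (i : Fin n)) id).transpose 0
    rw [Fintype.card_coe, hX, smul_zero] at h2
    have h3 : b • (((-1 : ℝ) ^ (q + 1) • distMatrix x (2 * q + 1)).submatrix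
        (fun i : X => (i : Fin n)) (fun i : X => (i : Fin n))) =
        c' • Matrix.of fun i j : X => ‖x i - x j‖ ^ (2 * q + 1) := by
      ext i j
      have h4 : ((-1 : ℝ) ^ (q + 1)) * (-1) ^ (q + 1) = 1 := by rw [← mul_pow]; simp
      simp only [b, Matrix.smul_apply, submatrix_apply, distMatrix, Matrix.of_apply, smul_eq_mul]
      linear_combination (c' * ‖x i - x j‖ ^ (2 * q + 1)) * h4
    rw [h3] at h2
    have h5 : ((-1 : ℝ) ^ p * b ^ m / b ^ p) * saddleMinor
        ((-1 : ℝ) ^ (q + 1) • distMatrix x (2 * q + 1)) (vandermondeLE x q) X =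
        (fromBlocks (c' • Matrix.of fun i j : X => ‖x i - x j‖ ^ (2 * q + 1))
          ((vandermondeLE x q).submatrix (fun i : X => (i : Fin n)) id)
          ((vandermondeLE x q).submatrix (fun i : X => (i : Fin n)) id).transpose 0).det := by
      rw [div_mul_eq_mul_div, div_eq_iff (pow_ne_zero _ hb), mul_comm _ (b ^ p), h2, saddleMinor]
      linear_combination (b ^ m * (fromBlocks
        (((-1 : ℝ) ^ (q + 1) • distMatrix x (2 * q + 1)).submatrix (fun i : X => (i : Fin n))
          (fun i : X => (i : Fin n)))
        ((vandermondeLE x q).submatrix (fun i : X => (i : Fin n)) id)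
        ((vandermondeLE x q).submatrix (fun i : X => (i : Fin n)) id).transpose 0).det) * h1
    rw [h5]
    exact hS X

theorem tendsto_ratio {α : Type*} {l : Filter ℝ} {s : Finset α} {S : α → ℝ → ℝ} {L : α → ℝ}
    {γ : ℝ} (hγ : γ ≠ 0) (hS : ∀ Y ∈ s, Tendsto (S Y) l (𝓝 (γ * L Y))) (hL : ∑ Y ∈ s, L Y ≠ 0)
    {X : α} (hX : X ∈ s) :
    Tendsto (fun ε => S X ε / ∑ Y ∈ s, S Y ε) l (𝓝 (L X / ∑ Y ∈ s, L Y)) := by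
  have h := (hS X hX).div (tendsto_finsetSum s hS)
    (by rw [← Finset.mul_sum]; exact mul_ne_zero hγ hL)
  rwa [← Finset.mul_sum, mul_div_mul_left _ _ hγ] at h

end Laws

theorem mainTheorem1 (d n r m : ℕ) (hd : 1 ≤ d) (hr : 1 ≤ r)
    (x : Fin n → E d) (hx : Function.Injective x)
    (hV : LinearIndependent ℝ (vandermondeLE x (r - 1)).col)
    (hm : polyDim (r - 1) d ≤ m) (hmn : m ≤ n) :
    ∃ Pstar : PMF (Finset (Fin n)),
      IsFixedSizePPDPP m ((-1 : ℝ) ^ r • distMatrix x (2 * r - 1)) (vandermondeLE x (r - 1))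
        Pstar ∧
      ∀ (κ : E d → E d → ℝ) (f : ℝ → ℝ), IsStationaryKernel κ f → HasSmoothnessOrder f r →
        (∀ᶠ ε in 𝓝[>] (0 : ℝ),
          ∃ P : PMF (Finset (Fin n)), IsFixedSizeLEnsemble m (kernelMatrix κ ε x) P) ∧
        ∀ P : ℝ → PMF (Finset (Fin n)),
          (∀ᶠ ε in 𝓝[>] (0 : ℝ), IsFixedSizeLEnsemble m (kernelMatrix κ ε x) (P ε)) →
          ∀ X : Finset (Fin n), Tendsto (fun ε => P ε X) (𝓝[>] 0) (𝓝 (Pstar X)) := by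
  obtain ⟨q, rfl⟩ := Nat.exists_eq_add_of_le' hr
  rw [show 2 * (q + 1) - 1 = 2 * q + 1 by omega]
  simp only [Nat.add_sub_cancel] at hV hm ⊢
  have hZ := sum_saddleMinor_pos hd hx hV hm hmn
  obtain ⟨Pstar, hPstar⟩ := exists_pmf_of_fixedSize (m := m)
    (fun X _ => saddleMinor_nonneg hd (q := q) hx X) hZ
  refine ⟨Pstar, ⟨isNonnegativePair_distMatrix hd hx hV, hPstar⟩, fun κ f hκ hf => ?_⟩
  obtain ⟨a, γ, S, ha, hγ, hminor, hS⟩ := exists_tendsto_principalMinor hd m x hκ hf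
  have hmem : ∀ {Y : Finset (Fin n)}, Y ∈ Finset.powersetCard m Finset.univ ↔ Y.card = m := by
    simp [Finset.mem_powersetCard]
  have hsum : ∀ ε, 0 < ε → ∑ Y ∈ Finset.powersetCard m Finset.univ,
      principalMinor (kernelMatrix κ ε x) Y =
      a ε * ∑ Y ∈ Finset.powersetCard m Finset.univ, S Y ε := by
    intro ε hε
    rw [Finset.mul_sum]
    exact Finset.sum_congr rfl fun Y hY => hminor Y (hmem.1 hY) ε hε
  have hnonneg : ∀ ε Y, 0 ≤ principalMinor (kernelMatrix κ ε x) Y := fun ε Y =>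
    ((kernelMatrix_posSemidef hκ ε x).submatrix _).det_nonneg
  constructor
  · have hlim : Tendsto (fun ε => ∑ Y ∈ Finset.powersetCard m Finset.univ, S Y ε) (𝓝[>] 0)
        (𝓝 (∑ Y ∈ Finset.powersetCard m Finset.univ, γ * saddleMinor
          ((-1 : ℝ) ^ (q + 1) • distMatrix x (2 * q + 1)) (vandermondeLE x q) Y)) :=
      tendsto_finsetSum _ fun Y hY => hS Y (hmem.1 hY)
    -- The nonzero limit keeps the kernel normalisation nonzero for small `ε`. Its positivity then
    -- comes from semi-definiteness, so the signs of `a ε` and `γ` are not needed.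
    have hne := hlim.eventually_ne (by rw [← Finset.mul_sum]; exact mul_ne_zero hγ hZ.ne')
    filter_upwards [hne, self_mem_nhdsWithin] with ε hε hpos
    have hZε : 0 < ∑ Y ∈ Finset.powersetCard m Finset.univ,
        principalMinor (kernelMatrix κ ε x) Y :=
      lt_of_le_of_ne (Finset.sum_nonneg fun Y _ => hnonneg ε Y)
        (by rw [hsum ε hpos]; exact (mul_ne_zero (ha ε hpos) hε).symm)
    obtain ⟨P, hP⟩ := exists_pmf_of_fixedSize (m := m) (fun X _ => hnonneg ε X) hZε
    exact ⟨P, kernelMatrix_posSemidef hκ ε x, hP⟩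
  · intro P hP X
    rw [← ENNReal.tendsto_toReal_iff (fun ε => (P ε).apply_ne_top X) (Pstar.apply_ne_top X),
      hPstar X]
    by_cases hX : X.card = m
    · rw [if_pos hX]
      refine (tendsto_ratio hγ (fun Y hY => hS Y (hmem.1 hY)) hZ.ne' (hmem.2 hX)).congr' ?_
      filter_upwards [hP, self_mem_nhdsWithin] with ε hε hpos
      rw [hε.mass X, if_pos hX, hsum ε hpos, hminor X hX ε hpos, mul_div_mul_left _ _ (ha ε hpos)]
    · rw [if_neg hX]
      refine tendsto_const_nhds.congr' ?_
      filter_upwards [hP] with ε hε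
      rw [hε.mass X, if_neg hX]
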